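/- Let $R$ and $S$ be associative unital rings. A module $M$ is *super finitely presented* if it has a resolution $\cdots\to P_1\to P_0\to M\to 0$ by finitely generated projective modules. Let $C={}_SC_R$ be a *faithfully semidualizing* $(S,R)$-bimodule, that is: * ${}_SC$ and $C_R$ are super finitely presented; * the homothety maps $S\to\operatorname{Hom}_{R^{op}}(C,C)$ and $R\to\operatorname{Hom}_S(C,C)$ are isomorphisms; * $\operatorname{Ext}^i_S(C,C)=0=\operatorname{Ext}^i_{R^{op}}(C,C)$ for all $i\ge 1$; * for every left $S$-module $N$, $\operatorname{Hom}_S(C,N)=0$ implies $N=0$, and for every right $R$-module $M$, $\operatorname{Hom}_{R^{op}}(C,M)=0$ implies $M=0$. A left $R$-module $F$ is *weak flat* if $\operatorname{Tor}_1^R(N,F)=0$ for every super finitely presented right $R$-module $N$; a left $S$-module $I$ is *weak injective* if $\operatorname{Ext}^1_S(N,I)=0$ for every super finitely presented left $S$-module $N$. Let $\mathcal{WF}_C(S)$ be the class of left $S$-modules isomorphic to $C\otimes_R F$ for some weak flat left $R$-module $F$, and let $\mathcal{WI}_C(R)$ be the class of left $R$-modules isomorphic to $\operatorname{Hom}_S(C,I)$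 for some weak injective left $S$-module $I$. A short exact sequence $0\to A\to B\to D\to 0$ of left modules is *pure exact* if $\operatorname{Hom}(P,B)\to\operatorname{Hom}(P,D)$ is surjective for every finitely presented module $P$; then $A$ is called a *pure submodule* and $D$ a *pure quotient* of $B$. Then: 1. the class $\mathcal{WF}_C(S)$ is closed under pure submodules and pure quotients; 2. the class $\mathcal{WI}_C(R)$ is closed under pure submodules and pure quotients. -/

import Mathlib

open CategoryTheory MulOpposite
open scoped TensorProduct

universe u

namespace SemidualizingBimodule

noncomputable section

/-! Conventions: rings are associative and unital, `Module R M` is a left `R`-module, and a right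
`R`-module is a left module over the opposite ring, `Module Rᵐᵒᵖ N`, the element `n r` being
`op r • n`. An `(S, R)`-bimodule is `Module S C`, `Module Rᵐᵒᵖ C`, `SMulCommClass S Rᵐᵒᵖ C`. -/

/-! ### Tensor products over a noncommutative ring -/

section Tensor

/-- The elements `(n r) ⊗ m - n ⊗ (r m)` of `N ⊗_ℤ M`. -/
def balancingRelations (R : Type u) [Ring R] (N : Type u) [AddCommGroup N] [Module Rᵐᵒᵖ N]
    (M : Type u) [AddCommGroup M] [Module R M] : Set (N ⊗[ℤ] M) :=
  {x | ∃ (n : N) (r : R) (m : M), x = (op r • n) ⊗ₜ[ℤ] m - n ⊗ₜ[ℤ] (r • m)}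

/-- The additive group `N ⊗_R M`, for a right `R`-module `N` and a left `R`-module `M`: the
quotient of `N ⊗_ℤ M` by the subgroup generated by the balancing relations. -/
abbrev Tensor (R : Type u) [Ring R] (N : Type u) [AddCommGroup N] [Module Rᵐᵒᵖ N]
    (M : Type u) [AddCommGroup M] [Module R M] : Type u :=
  (N ⊗[ℤ] M) ⧸ AddSubgroup.closure (balancingRelations R N M)

/-- For an `(S, R)`-bimodule `N`, the subgroup generated by the balancing relations, as an
`S`-submodule of `N ⊗_ℤ M`, where `s (n ⊗ m) = (s n) ⊗ m`. -/
def balancingSubmodule (S R : Type u) [Ring S] [Ring R]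
    (N : Type u) [AddCommGroup N] [Module S N] [Module Rᵐᵒᵖ N] (M : Type u) [AddCommGroup M]
    [Module R M] [SMulCommClass S Rᵐᵒᵖ N] : Submodule S (N ⊗[ℤ] M) :=
  { AddSubgroup.closure (balancingRelations R N M) with
    smul_mem' := by
      intro s x hx
      change s • x ∈ AddSubgroup.closure (balancingRelations R N M)
      change x ∈ AddSubgroup.closure (balancingRelations R N M) at hx
      induction hx using AddSubgroup.closure_induction with
      | mem x hx =>
        obtain ⟨n, r, m, rfl⟩ := hx
        refine AddSubgroup.subset_closure ⟨s • n, r, m, ?_⟩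
        rw [smul_sub, TensorProduct.smul_tmul', TensorProduct.smul_tmul', smul_comm]
      | zero => rw [smul_zero]; exact zero_mem _
      | add x y _ _ hx hy => rw [smul_add]; exact add_mem hx hy
      | neg x _ hx => rw [smul_neg]; exact neg_mem hx }

/-- The left `S`-module `N ⊗_R M`, for an `(S, R)`-bimodule `N` and a left `R`-module `M`,
with `s (n ⊗ m) = (s n) ⊗ m`. Its additive group is `Tensor R N M`. -/
abbrev BimoduleTensor (S R : Type u) [Ring S] [Ring R]
    (N : Type u) [AddCommGroup N] [Module S N] [Module Rᵐᵒᵖ N] (M : Type u) [AddCommGroup M]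
    [Module R M] [SMulCommClass S Rᵐᵒᵖ N] : Type u :=
  (N ⊗[ℤ] M) ⧸ balancingSubmodule S R N M

end Tensor

section Tor

variable (R : Type u) [Ring R]

/-- The homomorphism `f ⊗_R M : N ⊗_R M → N' ⊗_R M`. -/
def Tensor.map {N N' : Type u} [AddCommGroup N] [Module Rᵐᵒᵖ N] [AddCommGroup N'] [Module Rᵐᵒᵖ N']
    (M : Type u) [AddCommGroup M] [Module R M] (f : N →ₗ[Rᵐᵒᵖ] N') :
    Tensor R N M →+ Tensor R N' M :=
  QuotientAddGroup.map _ _ (f.toAddMonoidHom.toIntLinearMap.rTensor M).toAddMonoidHom <| by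
    rw [AddSubgroup.closure_le]
    rintro _ ⟨n, r, m, rfl⟩
    refine AddSubgroup.subset_closure ⟨f n, r, m, ?_⟩
    simp

theorem Tensor.hom_ext {N M A : Type u} [AddCommGroup N] [Module Rᵐᵒᵖ N] [AddCommGroup M]
    [Module R M] [AddCommGroup A] {φ ψ : Tensor R N M →+ A}
    (h : ∀ (n : N) (m : M), φ (QuotientAddGroup.mk (n ⊗ₜ[ℤ] m)) =
      ψ (QuotientAddGroup.mk (n ⊗ₜ[ℤ] m))) : φ = ψ := by
  refine AddMonoidHom.ext fun x => ?_
  obtain ⟨x, rfl⟩ := QuotientAddGroup.mk_surjective x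
  induction x using TensorProduct.induction_on with
  | zero => rw [QuotientAddGroup.mk_zero, map_zero, map_zero]
  | tmul n m => exact h n m
  | add x y hx hy => rw [QuotientAddGroup.mk_add, map_add, map_add, hx, hy]

/-- The functor `- ⊗_R M` from right `R`-modules to abelian groups. -/
def tensorRight (M : Type u) [AddCommGroup M] [Module R M] :
    ModuleCat.{u} Rᵐᵒᵖ ⥤ AddCommGrpCat.{u} where
  obj N := AddCommGrpCat.of (Tensor R N M)
  map f := AddCommGrpCat.ofHom (Tensor.map R M f.hom)
  map_id N := by
    apply AddCommGrpCat.hom_ext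
    exact Tensor.hom_ext R (fun n m => rfl)
  map_comp f g := by
    apply AddCommGrpCat.hom_ext
    exact Tensor.hom_ext R (fun n m => rfl)

instance (M : Type u) [AddCommGroup M] [Module R M] : (tensorRight R M).Additive where
  map_add {N N' f g} := by
    apply AddCommGrpCat.hom_ext
    refine Tensor.hom_ext R (fun n m => ?_)
    exact congrArg (QuotientAddGroup.mk (s := AddSubgroup.closure (balancingRelations R N' M)))
      (TensorProduct.add_tmul (f.hom n) (g.hom n) m)

/-- `Tor_i^R(N, M)`, the value at the right `R`-module `N` of the `i`-th left derived functor
of `- ⊗_R M`. -/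
def Tor (i : ℕ) (N : Type u) [AddCommGroup N] [Module Rᵐᵒᵖ N]
    (M : Type u) [AddCommGroup M] [Module R M] : AddCommGrpCat.{u} :=
  ((tensorRight R M).leftDerived i).obj (ModuleCat.of Rᵐᵒᵖ N)

end Tor

/-! ### The left `R`-module `Hom_S(C, I)` -/

section Hom

variable (S R : Type u) [Ring S] [Ring R]
variable (C : Type u) [AddCommGroup C] [Module S C] [Module Rᵐᵒᵖ C] [SMulCommClass S Rᵐᵒᵖ C]
variable (I : Type u) [AddCommGroup I] [Module S I]

/-- For an `(S, R)`-bimodule `C` and a left `S`-module `I`, the group `Hom_S(C, I)`, made below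
into a left `R`-module by `(r φ)(c) = φ(c r)`. -/
@[nolint unusedArguments]
def BimoduleHom (S R : Type u) [Ring S] [Ring R]
    (C : Type u) [AddCommGroup C] [Module S C] [Module Rᵐᵒᵖ C] [SMulCommClass S Rᵐᵒᵖ C]
    (I : Type u) [AddCommGroup I] [Module S I] : Type u :=
  C →ₗ[S] I

instance : AddCommGroup (BimoduleHom S R C I) :=
  inferInstanceAs (AddCommGroup (C →ₗ[S] I))

instance : Module R (BimoduleHom S R C I) where
  smul r φ := LinearMap.comp (show C →ₗ[S] I from φ)
    ({ toFun := fun c => op r • c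
       map_add' := smul_add (op r)
       map_smul' := fun s c => (smul_comm s (op r) c).symm } : C →ₗ[S] C)
  one_smul φ := LinearMap.ext fun c => congrArg (show C →ₗ[S] I from φ) (one_smul Rᵐᵒᵖ c)
  mul_smul r r' φ := LinearMap.ext fun c =>
    congrArg (show C →ₗ[S] I from φ) (mul_smul (op r') (op r) c)
  smul_zero _ := LinearMap.ext fun _ => rfl
  smul_add _ _ _ := LinearMap.ext fun _ => rfl
  add_smul r r' φ := LinearMap.ext fun c =>
    (congrArg (show C →ₗ[S] I from φ) (add_smul (op r) (op r') c)).trans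
      (map_add (show C →ₗ[S] I from φ) (op r • c) (op r' • c))
  zero_smul φ := LinearMap.ext fun c =>
    (congrArg (show C →ₗ[S] I from φ) (zero_smul Rᵐᵒᵖ c)).trans
      (map_zero (show C →ₗ[S] I from φ))

end Hom

/-! ### Super finitely presented, weak injective and weak flat modules -/

/-- `M` has a projective resolution by finitely generated projective modules. -/
def SuperFinitelyPresented (R : Type u) [Ring R] (M : Type u) [AddCommGroup M] [Module R M] :
    Prop :=
  ∃ P : ProjectiveResolution (ModuleCat.of R M), ∀ n : ℕ, Module.Finite R (P.complex.X n)

/-- `Ext^i_R(M, N) = 0`. -/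
def ExtVanishes (R : Type u) [Ring R] (i : ℕ) (M N : Type u)
    [AddCommGroup M] [Module R M] [AddCommGroup N] [Module R N] : Prop :=
  Subsingleton (Abelian.Ext.{u} (ModuleCat.of R M) (ModuleCat.of R N) i)

/-- The left `R`-module `M` is weak injective: `Ext^1_R(F, M) = 0` for all super finitely
presented left `R`-modules `F`. -/
def WeakInjective (R : Type u) [Ring R] (M : Type u) [AddCommGroup M] [Module R M] : Prop :=
  ∀ (F : Type u) [AddCommGroup F] [Module R F],
    SuperFinitelyPresented R F → ExtVanishes R 1 F M

/-- The left `R`-module `M` is weak flat: `Tor_1^R(N, M) = 0` for all super finitely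
presented right `R`-modules `N`. -/
def WeakFlat (R : Type u) [Ring R] (M : Type u) [AddCommGroup M] [Module R M] : Prop :=
  ∀ (N : Type u) [AddCommGroup N] [Module Rᵐᵒᵖ N],
    SuperFinitelyPresented Rᵐᵒᵖ N → Limits.IsZero (Tor R 1 N M)

/-! ### Semidualizing bimodules and the two classes -/

section Semidualizing

variable (S R : Type u) [Ring S] [Ring R]
variable (C : Type u) [AddCommGroup C] [Module S C] [Module Rᵐᵒᵖ C] [SMulCommClass S Rᵐᵒᵖ C]

/-- `C` is a semidualizing `(S, R)`-bimodule. -/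
structure IsSemidualizing : Prop where
  left_superFinitelyPresented : SuperFinitelyPresented S C
  right_superFinitelyPresented : SuperFinitelyPresented Rᵐᵒᵖ C
  /-- The homothety map `S → Hom_{R^op}(C, C)`, `s ↦ (c ↦ s c)`, is bijective. -/
  left_homothety : Function.Bijective
    (fun s : S => ({ toFun := fun c => s • c
                     map_add' := smul_add s
                     map_smul' := fun r c => smul_comm s r c } : C →ₗ[Rᵐᵒᵖ] C))
  /-- The homothety map `R → Hom_S(C, C)`, `r ↦ (c ↦ c r)`, is bijective. -/
  right_homothety : Function.Bijective
    (fun r : R => ({ toFun := fun c => op r • c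
                     map_add' := smul_add (op r)
                     map_smul' := fun s c => (smul_comm s (op r) c).symm } : C →ₗ[S] C))
  left_ext : ∀ i : ℕ, 1 ≤ i → ExtVanishes S i C C
  right_ext : ∀ i : ℕ, 1 ≤ i → ExtVanishes Rᵐᵒᵖ i C C

/-- `C` is a faithfully semidualizing `(S, R)`-bimodule. -/
structure IsFaithfullySemidualizing : Prop extends IsSemidualizing S R C where
  left_faithful : ∀ (N : Type u) [AddCommGroup N] [Module S N],
    Subsingleton (C →ₗ[S] N) → Subsingleton N
  right_faithful : ∀ (M : Type u) [AddCommGroup M] [Module Rᵐᵒᵖ M],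
    Subsingleton (C →ₗ[Rᵐᵒᵖ] M) → Subsingleton M

/-- The left `S`-module `V` is `C`-weak flat: `V ≅ C ⊗_R F` for a weak flat left `R`-module `F`. -/
def CWeakFlat (V : Type u) [AddCommGroup V] [Module S V] : Prop :=
  ∃ (F : Type u) (_ : AddCommGroup F) (_ : Module R F),
    WeakFlat R F ∧ Nonempty (V ≃ₗ[S] BimoduleTensor S R C F)

/-- The left `R`-module `U` is `C`-weak injective: `U ≅ Hom_S(C, I)` for a weak injective left
`S`-module `I`. -/
def CWeakInjective (U : Type u) [AddCommGroup U] [Module R U] : Prop :=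
  ∃ (I : Type u) (_ : AddCommGroup I) (_ : Module S I),
    WeakInjective S I ∧ Nonempty (U ≃ₗ[R] BimoduleHom S R C I)

end Semidualizing

/-- `0 → A → B → D → 0` is a pure exact sequence of left `R`-modules; then `A` is a pure submodule
and `D` a pure quotient of `B`. -/
structure PureExact (R : Type u) [Ring R] {A B D : Type u} [AddCommGroup A] [Module R A]
    [AddCommGroup B] [Module R B] [AddCommGroup D] [Module R D]
    (f : A →ₗ[R] B) (g : B →ₗ[R] D) : Prop where
  injective : Function.Injective f
  exact : Function.Exact f g
  surjective : Function.Surjective g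
  lift : ∀ (P : Type u) [AddCommGroup P] [Module R P], Module.FinitePresentation R P →
    ∀ h : P →ₗ[R] D, ∃ k : P →ₗ[R] B, g ∘ₗ k = h

/-- `A` is (up to isomorphism) a pure submodule of `B`. -/
def IsPureSubmoduleOf (R : Type u) [Ring R] (A B : Type u) [AddCommGroup A] [Module R A]
    [AddCommGroup B] [Module R B] : Prop :=
  ∃ (D : Type u) (_ : AddCommGroup D) (_ : Module R D) (f : A →ₗ[R] B) (g : B →ₗ[R] D),
    PureExact R f g

/-- `D` is (up to isomorphism) a pure quotient of `B`. -/
def IsPureQuotientOf (R : Type u) [Ring R] (D B : Type u) [AddCommGroup D] [Module R D]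
    [AddCommGroup B] [Module R B] : Prop :=
  ∃ (A : Type u) (_ : AddCommGroup A) (_ : Module R A) (f : A →ₗ[R] B) (g : B →ₗ[R] D),
    PureExact R f g

end

end SemidualizingBimodule

/-! The functors C ⊗_R - and Hom_S(C, -) are adjoint. Let η : M → Hom_S(C, C ⊗ M) and ε : C ⊗
Hom_S(C, I) → I be the unit and counit. Four facts carry the argument.

(a) Weak flat and weak injective modules are closed under pure submodules and pure quotients
(`SystemPure.weakFlat_left` and its three companions), because super finitely presented modules and
their syzygies are finitely presented.

(b) Both functors preserve pure exactness (`SystemPure.bimoduleHom`, `SystemPure.bimoduleTensor`),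
because C is finitely presented on each side.

(c) η is bijective at weak flat M and ε at weak injective I (`IsSemidualizing.unitMap_bijective`,
`IsSemidualizing.counitMap_bijective`). Dualizing a finite presentation of C into C gives 0 → R →
C^k → C^l, or the same with S. All terms and successive cokernels are super finitely presented, so -
⊗ M, or Hom_S(-, I), keeps the sequence exact.

(d) Hom_S(C, N) = 0 forces N = 0, and C ⊗_R M = 0 forces M = 0.

For 0 → W → V → D → 0 pure with V ≅ C ⊗ F, (c) gives Hom_S(C, V) ≅ F. By (a) and (b), Hom_S(C, W)
and Hom_S(C, D) are then weak flat, and it remains to see that ε is bijective at W and D. At D,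
surjectivity comes from V, and the kernel vanishes by (c) and (d). At W a diagram chase finishes.
The weak injective case is dual: first η is bijective at the submodule, where (d) kills the
cokernel, and then at the quotient. -/

namespace SemidualizingBimodule

/-! ### Super finitely presented modules: syzygies, extensions, cokernels. -/

section Resolution

variable {R : Type u} [Ring R]

/-- A class of modules each of whose members is the quotient of a finitely generated projective
module by a member of the class. -/
def SyzygyClosed (𝒳 : ModuleCat.{u} R → Prop) : Prop :=
  ∀ M, 𝒳 M → ∃ (P K : ModuleCat.{u} R) (i : K →ₗ[R] P) (p : P →ₗ[R] M),
    Module.Projective R P ∧ Module.Finite R P ∧ 𝒳 K ∧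
      Function.Injective i ∧ Function.Exact i p ∧ Function.Surjective p

theorem moduleCat_exact_iff {X Y Z : ModuleCat.{u} R} (f : X ⟶ Y) (g : Y ⟶ Z) (w : f ≫ g = 0) :
    (ShortComplex.mk f g w).Exact ↔ Function.Exact f.hom g.hom :=
  ShortComplex.ShortExact.moduleCat_exact_iff_function_exact _

/-- Choosing syzygies repeatedly and splicing the short exact sequences yields the resolution. This
is a coinduction principle: to show that M is super finitely presented, it suffices to find a
syzygy-closed class containing M, with no complexes involved. -/
theorem SyzygyClosed.superFinitelyPresented {𝒳 : ModuleCat.{u} R → Prop} (h𝒳 : SyzygyClosed 𝒳)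
    {M : Type u} [AddCommGroup M] [Module R M] (hM : 𝒳 (ModuleCat.of R M)) :
    SuperFinitelyPresented R M := by
  choose P K i p hP hfin hK hi hip hp using h𝒳
  let syz : ℕ → {M : ModuleCat.{u} R // 𝒳 M} := fun n =>
    Nat.rec ⟨_, hM⟩ (fun _ N => ⟨K N.1 N.2, hK N.1 N.2⟩) n
  let X : ℕ → ModuleCat.{u} R := fun n => P (syz n).1 (syz n).2
  let q : ∀ n, X n →ₗ[R] (syz n).1 := fun n => p (syz n).1 (syz n).2
  let j : ∀ n, (syz (n + 1)).1 →ₗ[R] X n := fun n => i (syz n).1 (syz n).2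
  let d : ∀ n, X (n + 1) ⟶ X n := fun n => ModuleCat.ofHom (j n ∘ₗ q (n + 1))
  have hqj : ∀ n, q n ∘ₗ j n = 0 := fun n => (hip (syz n).1 (syz n).2).linearMap_comp_eq_zero
  have hd : ∀ n, d (n + 1) ≫ d n = 0 := by
    intro n
    apply ModuleCat.hom_ext
    refine LinearMap.ext fun x => ?_
    have h : q (n + 1) (j (n + 1) (q (n + 2) x)) = 0 := LinearMap.congr_fun (hqj (n + 1)) _
    exact (congrArg (j n) h).trans (map_zero _)
  have hex : ∀ n, Function.Exact (d n).hom (q n) := by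
    intro n x
    refine (hip (syz n).1 (syz n).2 x).trans ⟨?_, ?_⟩
    · rintro ⟨y, rfl⟩
      obtain ⟨z, rfl⟩ := hp _ (hK (syz n).1 (syz n).2) y
      exact ⟨z, rfl⟩
    · rintro ⟨z, rfl⟩
      exact ⟨q (n + 1) z, rfl⟩
  have hexd : ∀ n, Function.Exact (d (n + 1)).hom (d n).hom := by
    intro n x
    refine Iff.trans ?_ (hex (n + 1) x)
    exact map_eq_zero_iff (j n) (hi _ _)
  let cx : ChainComplex (ModuleCat.{u} R) ℕ := ChainComplex.of X d hd
  have hcx : ∀ n, cx.d (n + 1) n = d n := fun n => ChainComplex.of_d X d n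
  have hw : cx.d 1 0 ≫ ModuleCat.ofHom (q 0) = 0 := by
    rw [hcx]
    apply ModuleCat.hom_ext
    exact (hex 0).linearMap_comp_eq_zero
  have hproj : ∀ n, Projective (cx.X n) := fun n =>
    (IsProjective.iff_projective (R := R) (X n)).1 (hP _ _)
  have hexact : ∀ n, cx.ExactAt (n + 1) := by
    intro n
    rw [HomologicalComplex.exactAt_iff' _ (n + 1 + 1) (n + 1) n (by simp) (by simp)]
    refine (moduleCat_exact_iff _ _ _).2 ?_
    rw [hcx, hcx]
    exact hexd n
  refine ⟨{ complex := cx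
            projective := hproj
            π := (ChainComplex.toSingle₀Equiv _ _).symm ⟨ModuleCat.ofHom (q 0), hw⟩
            quasiIso := ⟨fun n => ?_⟩ }, fun n => hfin _ _⟩
  cases n with
  | zero =>
    rw [ChainComplex.quasiIsoAt₀_iff, ShortComplex.quasiIso_iff_of_zeros']
    · refine (ShortComplex.exact_and_epi_g_iff_of_iso ?_ (S₂ := ShortComplex.mk _ _ hw)).2
        ⟨?_, ?_⟩
      · exact ShortComplex.isoMk (Iso.refl _) (Iso.refl _) (Iso.refl _)
          ((Category.id_comp _).trans (Category.comp_id _).symm)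
          ((Category.id_comp _).trans (Category.comp_id _).symm)
      · refine (moduleCat_exact_iff _ _ _).2 ?_
        rw [hcx]
        exact hex 0
      · exact (ModuleCat.epi_iff_surjective _).2 (hp _ _)
    all_goals rfl
  | succ n =>
    rw [quasiIsoAt_iff_exactAt']
    · exact hexact n
    · exact ChainComplex.exactAt_succ_single_obj _ _

theorem resolution_exact (M : Type u) [AddCommGroup M] [Module R M]
    (P : ProjectiveResolution (ModuleCat.of R M)) :
    (∃ p : P.complex.X 0 →ₗ[R] M, Function.Surjective p ∧ Function.Exact (P.complex.d 1 0).hom p) ∧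
      ∀ n, Function.Exact (P.complex.d (n + 2) (n + 1)).hom (P.complex.d (n + 1) n).hom := by
  refine ⟨⟨(P.π.f 0).hom, ?_, ?_⟩, fun n => (moduleCat_exact_iff _ _ _).1 (P.exact_succ n)⟩
  · exact (ModuleCat.epi_iff_surjective (P.π.f 0)).1 inferInstance
  · exact (moduleCat_exact_iff _ _ P.complex_d_comp_π_f_zero).1 P.exact₀

theorem syzygyClosed_superFinitelyPresented :
    SyzygyClosed (fun M : ModuleCat.{u} R => SuperFinitelyPresented R M) := by
  rintro M ⟨P, hfin⟩
  obtain ⟨⟨p, hp, hex⟩, hd⟩ := resolution_exact M P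
  have hproj : ∀ n, Module.Projective R (P.complex.X n) := fun n =>
    (IsProjective.iff_projective (R := R) (P.complex.X n)).2 (P.projective n)
  refine ⟨P.complex.X 0, ModuleCat.of R (LinearMap.ker p), (LinearMap.ker p).subtype, p, hproj 0,
    hfin 0, ?_, Subtype.val_injective, LinearMap.exact_subtype_ker_map p, hp⟩
  -- The cokernels of the differentials of the given resolution; the kernel of the augmentation is
  -- the one with n = 1.
  let 𝒳 : ModuleCat.{u} R → Prop := fun N => ∃ (n : ℕ) (q : P.complex.X n →ₗ[R] N),
    Function.Surjective q ∧ Function.Exact (P.complex.d (n + 1) n).hom q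
  have h𝒳 : SyzygyClosed 𝒳 := by
    rintro N ⟨n, q, hq, hqex⟩
    have hmem : ∀ x, (P.complex.d (n + 1) n).hom x ∈ LinearMap.ker q := fun x => (hqex _).2 ⟨x, rfl⟩
    refine ⟨P.complex.X n, ModuleCat.of R (LinearMap.ker q), (LinearMap.ker q).subtype, q, hproj n,
      hfin n, ⟨n + 1, (P.complex.d (n + 1) n).hom.codRestrict _ hmem, ?_, ?_⟩,
      Subtype.val_injective, LinearMap.exact_subtype_ker_map q, hq⟩
    · rintro ⟨y, hy⟩
      obtain ⟨x, rfl⟩ := (hqex y).1 hy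
      exact ⟨x, rfl⟩
    · intro x
      rw [← hd n x, Subtype.ext_iff]
      rfl
  have hmem : ∀ x, (P.complex.d 1 0).hom x ∈ LinearMap.ker p := fun x => (hex _).2 ⟨x, rfl⟩
  refine h𝒳.superFinitelyPresented ⟨1, (P.complex.d 1 0).hom.codRestrict _ hmem, ?_, ?_⟩
  · rintro ⟨y, hy⟩
    obtain ⟨x, rfl⟩ := (hex y).1 hy
    exact ⟨x, rfl⟩
  · intro x
    rw [← hd 0 x, Subtype.ext_iff]
    rfl

variable {A B D : Type u} [AddCommGroup A] [Module R A] [AddCommGroup B] [Module R B]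
  [AddCommGroup D] [Module R D]

theorem SuperFinitelyPresented.exists_syzygy (hA : SuperFinitelyPresented R A) :
    ∃ (P K : Type u) (_ : AddCommGroup P) (_ : Module R P) (_ : AddCommGroup K) (_ : Module R K)
      (i : K →ₗ[R] P) (p : P →ₗ[R] A), Module.Projective R P ∧ Module.Finite R P ∧
      SuperFinitelyPresented R K ∧
      Function.Injective i ∧ Function.Exact i p ∧ Function.Surjective p := by
  obtain ⟨P, K, i, p, h⟩ := syzygyClosed_superFinitelyPresented (ModuleCat.of R A) hA
  exact ⟨P, K, inferInstance, inferInstance, inferInstance, inferInstance, i, p, h⟩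

theorem SuperFinitelyPresented.of_syzygy {P K : Type u} [AddCommGroup P] [Module R P]
    [AddCommGroup K] [Module R K] [Module.Projective R P] [Module.Finite R P]
    (hK : SuperFinitelyPresented R K) (i : K →ₗ[R] P) (p : P →ₗ[R] A)
    (hi : Function.Injective i) (hip : Function.Exact i p) (hp : Function.Surjective p) :
    SuperFinitelyPresented R A := by
  refine SyzygyClosed.superFinitelyPresented
    (𝒳 := fun N => SuperFinitelyPresented R N ∨ N = ModuleCat.of R A) ?_ (.inr rfl)
  rintro N (hN | rfl)
  · obtain ⟨P, K, i, p, h₁, h₂, h₃, h⟩ := syzygyClosed_superFinitelyPresented N hN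
    exact ⟨P, K, i, p, h₁, h₂, .inl h₃, h⟩
  · exact ⟨ModuleCat.of R P, ModuleCat.of R K, i, p, inferInstanceAs (Module.Projective R P),
      inferInstanceAs (Module.Finite R P), .inl hK, hi, hip, hp⟩

theorem SuperFinitelyPresented.finite (hA : SuperFinitelyPresented R A) : Module.Finite R A := by
  obtain ⟨P, K, _, _, _, _, i, p, _, _, _, _, _, hp⟩ := hA.exists_syzygy
  exact Module.Finite.of_surjective p hp

theorem SuperFinitelyPresented.finitePresentation (hA : SuperFinitelyPresented R A) :
    Module.FinitePresentation R A := by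
  obtain ⟨P, K, _, _, _, _, i, p, _, _, hK, hi, hip, hp⟩ := hA.exists_syzygy
  have := hK.finite
  have := Module.finitePresentation_of_projective R P
  refine Module.finitePresentation_of_surjective p hp ?_
  rw [LinearMap.exact_iff.1 hip]
  exact Module.Finite.iff_fg.1 inferInstance

/-- Horseshoe lemma, applied to the class of all such extensions: P ⊕ Q covers the middle term, and
the kernel of the cover is again an extension of one syzygy by the other. -/
theorem SuperFinitelyPresented.extension (hA : SuperFinitelyPresented R A)
    (hD : SuperFinitelyPresented R D) (f : A →ₗ[R] B) (g : B →ₗ[R] D)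
    (hf : Function.Injective f) (hfg : Function.Exact f g) (hg : Function.Surjective g) :
    SuperFinitelyPresented R B := by
  refine SyzygyClosed.superFinitelyPresented
    (𝒳 := fun N => ∃ (A D : ModuleCat.{u} R) (f : A →ₗ[R] N) (g : N →ₗ[R] D),
      SuperFinitelyPresented R A ∧ SuperFinitelyPresented R D ∧
      Function.Injective f ∧ Function.Exact f g ∧ Function.Surjective g) ?_
    ⟨ModuleCat.of R A, ModuleCat.of R D, f, g, hA, hD, hf, hfg, hg⟩
  rintro N ⟨A, D, f, g, hA, hD, hf, hfg, hg⟩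
  obtain ⟨P, K, _, _, _, _, i, p, _, _, hK, hi, hip, hp⟩ := hA.exists_syzygy
  obtain ⟨Q, L, _, _, _, _, j, q, _, _, hL, hj, hjq, hq⟩ := hD.exists_syzygy
  obtain ⟨t, ht⟩ := Module.projective_lifting_property g q hg
  have ht' : ∀ x, g (t x) = q x := fun x => LinearMap.congr_fun ht x
  have hgf : ∀ x, g (f x) = 0 := hfg.apply_apply_eq_zero
  have hpi : ∀ x, p (i x) = 0 := hip.apply_apply_eq_zero
  have hqj : ∀ x, q (j x) = 0 := hjq.apply_apply_eq_zero
  let c : (P × Q) →ₗ[R] N := (f ∘ₗ p).coprod t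
  have hc : ∀ x y, c (x, y) = f (p x) + t y := fun x y => rfl
  have hK₁ : ∀ x, LinearMap.inl R P Q (i x) ∈ LinearMap.ker c := by
    intro x
    simp [hc, hpi]
  have hK₂ : ∀ x : LinearMap.ker c, ∃ y, j y = (x : P × Q).2 := by
    rintro ⟨⟨x, y⟩, hx⟩
    refine (hjq y).1 ?_
    rw [LinearMap.mem_ker, hc] at hx
    simpa [hgf, ht'] using congrArg g hx
  let e := LinearEquiv.ofInjective j hj
  let s : LinearMap.ker c →ₗ[R] L := e.symm.toLinearMap ∘ₗ
    (LinearMap.snd R P Q ∘ₗ (LinearMap.ker c).subtype).codRestrict (LinearMap.range j) hK₂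
  have hs : ∀ x, j (s x) = (x : P × Q).2 := fun x =>
    congrArg Subtype.val (e.apply_symm_apply ⟨(x : P × Q).2, hK₂ x⟩)
  refine ⟨ModuleCat.of R (P × Q), ModuleCat.of R (LinearMap.ker c), (LinearMap.ker c).subtype, c,
    inferInstanceAs (Module.Projective R (P × Q)), inferInstanceAs (Module.Finite R (P × Q)),
    ⟨ModuleCat.of R K, ModuleCat.of R L, (LinearMap.inl R P Q ∘ₗ i).codRestrict _ hK₁, s, hK, hL,
      ?_, ?_, ?_⟩, Subtype.val_injective, LinearMap.exact_subtype_ker_map c, ?_⟩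
  · intro x y hxy
    exact hi (congrArg Prod.fst (Subtype.ext_iff.1 hxy))
  · rintro ⟨⟨x, y⟩, hx⟩
    rw [← map_eq_zero_iff j hj, hs]
    constructor
    · intro h
      change y = 0 at h
      subst h
      rw [LinearMap.mem_ker, hc, map_zero, add_zero, map_eq_zero_iff f hf] at hx
      obtain ⟨z, rfl⟩ := (hip x).1 hx
      exact ⟨z, rfl⟩
    · rintro ⟨z, hz⟩
      exact (congrArg Prod.snd (Subtype.ext_iff.1 hz)).symm
  · intro y
    have hy : g (t (j y)) = 0 := by rw [ht', hqj]
    obtain ⟨a, ha⟩ := (hfg _).1 hy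
    obtain ⟨x, rfl⟩ := hp a
    -- The sign makes f (p x) cancel t (j y), which it equals.
    refine ⟨⟨(-x, j y), ?_⟩, hj ?_⟩
    · rw [LinearMap.mem_ker, hc, map_neg, map_neg, ha, neg_add_cancel]
    · rw [hs]
  · intro b
    obtain ⟨y, hy⟩ := hq (g b)
    have hb : g (b - t y) = 0 := by rw [map_sub, ht', hy, sub_self]
    obtain ⟨a, ha⟩ := (hfg _).1 hb
    obtain ⟨x, rfl⟩ := hp a
    exact ⟨(x, y), by rw [hc, ha, sub_add_cancel]⟩

/-- Cover B by P with kernel K. The kernel of the composite P → D is the preimage of A in P, hence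
an extension of A by K, so it is super finitely presented and serves as a syzygy of D. -/
theorem SuperFinitelyPresented.cokernel (hA : SuperFinitelyPresented R A)
    (hB : SuperFinitelyPresented R B) (f : A →ₗ[R] B) (g : B →ₗ[R] D)
    (hf : Function.Injective f) (hfg : Function.Exact f g) (hg : Function.Surjective g) :
    SuperFinitelyPresented R D := by
  obtain ⟨P, K, _, _, _, _, i, p, _, _, hK, hi, hip, hp⟩ := hB.exists_syzygy
  have hpi : ∀ x, p (i x) = 0 := hip.apply_apply_eq_zero
  have hL : ∀ x : LinearMap.ker (g ∘ₗ p), ∃ y, f y = p x := fun x => (hfg _).1 x.2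
  let e := LinearEquiv.ofInjective f hf
  let s : LinearMap.ker (g ∘ₗ p) →ₗ[R] A := e.symm.toLinearMap ∘ₗ
    (p ∘ₗ (LinearMap.ker (g ∘ₗ p)).subtype).codRestrict (LinearMap.range f) hL
  have hs : ∀ x, f (s x) = p x := fun x =>
    congrArg Subtype.val (e.apply_symm_apply ⟨p x, hL x⟩)
  have hK₁ : ∀ x, i x ∈ LinearMap.ker (g ∘ₗ p) := by
    intro x
    simp [hpi]
  refine SuperFinitelyPresented.of_syzygy (P := P) (K := LinearMap.ker (g ∘ₗ p)) ?_
    (LinearMap.ker (g ∘ₗ p)).subtype (g ∘ₗ p) Subtype.val_injective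
    (LinearMap.exact_subtype_ker_map _) (hg.comp hp)
  refine hK.extension hA (i.codRestrict _ hK₁) s ?_ ?_ ?_
  · intro x y hxy
    exact hi (Subtype.ext_iff.1 hxy)
  · rintro ⟨x, hx⟩
    rw [← map_eq_zero_iff f hf, hs]
    refine (hip x).trans ⟨?_, ?_⟩
    · rintro ⟨z, rfl⟩
      exact ⟨z, rfl⟩
    · rintro ⟨z, hz⟩
      exact ⟨z, Subtype.ext_iff.1 hz⟩
  · intro a
    obtain ⟨x, hx⟩ := hp (f a)
    refine ⟨⟨x, ?_⟩, hf ?_⟩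
    · rw [LinearMap.mem_ker, LinearMap.comp_apply, hx]
      exact hfg.apply_apply_eq_zero a
    · rw [hs, hx]

theorem superFinitelyPresented_of_subsingleton [Subsingleton A] : SuperFinitelyPresented R A :=
  SyzygyClosed.superFinitelyPresented (𝒳 := fun N => Subsingleton N)
    (fun N (_ : Subsingleton N) => ⟨N, N, LinearMap.id, LinearMap.id,
      (Module.Projective.of_free : Module.Projective R N), inferInstance, inferInstance,
      Function.injective_id, fun x => ⟨fun _ => ⟨x, rfl⟩, fun _ => Subsingleton.elim _ _⟩,
      Function.surjective_id⟩) (inferInstanceAs (Subsingleton A))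

theorem superFinitelyPresented_of_projective [Module.Projective R A] [Module.Finite R A] :
    SuperFinitelyPresented R A :=
  SuperFinitelyPresented.of_syzygy (P := A) (K := PUnit) superFinitelyPresented_of_subsingleton
    0 LinearMap.id (Function.injective_of_subsingleton _)
    (fun _ => ⟨fun h => ⟨0, h.symm⟩, fun ⟨_, h⟩ => h.symm⟩) Function.surjective_id

theorem SuperFinitelyPresented.pi (hA : SuperFinitelyPresented R A) (n : ℕ) :
    SuperFinitelyPresented R (Fin n → A) := by
  induction n with
  | zero => exact superFinitelyPresented_of_subsingleton
  | succ n ih =>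
    refine hA.extension ih (LinearMap.single R (fun _ => A) (0 : Fin (n + 1)))
      (LinearMap.funLeft R A Fin.succ) (fun x y h => Pi.single_injective (0 : Fin (n + 1)) h) ?_ ?_
    · intro x
      constructor
      · intro h
        refine ⟨x 0, ?_⟩
        funext k
        refine Fin.cases ?_ (fun k => ?_) k
        · simp
        · simpa using (congrFun h k).symm
      · rintro ⟨a, rfl⟩
        funext k
        simp [LinearMap.funLeft_apply]
    · exact LinearMap.funLeft_surjective_of_injective R A _ (Fin.succ_injective n)

end Resolution

/-! ### Tensor products over a noncommutative ring: right exactness, finite powers, vanishing. -/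

/-- Exactness survives passing to quotients when every relation in the third group lifts to one in
the second: subtract the lifted relation, then use exactness upstairs. This transfers right
exactness from ⊗_ℤ to ⊗_R. -/
theorem quotientAddGroup_map_exact {A B D : Type*} [AddCommGroup A] [AddCommGroup B]
    [AddCommGroup D] {f : A →+ B} {g : B →+ D} (h : Function.Exact f g) {H : AddSubgroup A}
    {K : AddSubgroup B} {L : AddSubgroup D} (hf : H ≤ K.comap f) (hg : K ≤ L.comap g)
    (hL : L ≤ K.map g) :
    Function.Exact (QuotientAddGroup.map H K f hf) (QuotientAddGroup.map K L g hg) := by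
  intro x
  obtain ⟨b, rfl⟩ := QuotientAddGroup.mk_surjective x
  constructor
  · intro hb
    obtain ⟨b', hb', hbb'⟩ := hL ((QuotientAddGroup.eq_zero_iff _).1 hb)
    obtain ⟨a, ha⟩ := (h (b - b')).1 (by rw [map_sub, hbb', sub_self])
    refine ⟨QuotientAddGroup.mk a, ?_⟩
    rw [QuotientAddGroup.map_mk, ha, QuotientAddGroup.mk_sub,
      (QuotientAddGroup.eq_zero_iff b').2 hb', sub_zero]
  · rintro ⟨a, ha⟩
    obtain ⟨a, rfl⟩ := QuotientAddGroup.mk_surjective a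
    rw [← ha, QuotientAddGroup.map_mk, QuotientAddGroup.map_mk, h.apply_apply_eq_zero]
    rfl

section Tensor

variable {R : Type u} [Ring R]
variable {N N' N'' : Type u} [AddCommGroup N] [Module Rᵐᵒᵖ N] [AddCommGroup N'] [Module Rᵐᵒᵖ N']
  [AddCommGroup N''] [Module Rᵐᵒᵖ N'']
variable {M M' M'' : Type u} [AddCommGroup M] [Module R M] [AddCommGroup M'] [Module R M']
  [AddCommGroup M''] [Module R M'']

/-- The element `n ⊗ m` of `N ⊗_R M`. -/
def Tensor.tmul (R : Type u) [Ring R] {N M : Type u} [AddCommGroup N] [Module Rᵐᵒᵖ N]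
    [AddCommGroup M] [Module R M] (n : N) (m : M) : Tensor R N M :=
  QuotientAddGroup.mk (n ⊗ₜ[ℤ] m)

/-- The biadditive map `(n, m) ↦ n ⊗ m`. -/
def Tensor.mkHom (R : Type u) [Ring R] (N M : Type u) [AddCommGroup N] [Module Rᵐᵒᵖ N]
    [AddCommGroup M] [Module R M] : N →+ M →+ Tensor R N M :=
  AddMonoidHom.mk' (fun n => AddMonoidHom.mk' (Tensor.tmul R n) (fun m m' =>
      congrArg (QuotientAddGroup.mk (s := AddSubgroup.closure (balancingRelations R N M)))
        (TensorProduct.tmul_add n m m')))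
    (fun n n' => AddMonoidHom.ext fun m =>
      congrArg (QuotientAddGroup.mk (s := AddSubgroup.closure (balancingRelations R N M)))
        (TensorProduct.add_tmul n n' m))

theorem Tensor.mkHom_apply (n : N) (m : M) : Tensor.mkHom R N M n m = Tensor.tmul R n m := rfl

theorem Tensor.smul_tmul (r : R) (n : N) (m : M) :
    Tensor.tmul R (op r • n) m = Tensor.tmul R n (r • m) := by
  rw [← sub_eq_zero]
  exact (QuotientAddGroup.eq_zero_iff _).2 (AddSubgroup.subset_closure ⟨n, r, m, rfl⟩)

theorem Tensor.add_tmul (n n' : N) (m : M) :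
    Tensor.tmul R (n + n') m = Tensor.tmul R n m + Tensor.tmul R n' m :=
  DFunLike.congr_fun (map_add (Tensor.mkHom R N M) n n') m

theorem Tensor.tmul_add (n : N) (m m' : M) :
    Tensor.tmul R n (m + m') = Tensor.tmul R n m + Tensor.tmul R n m' :=
  map_add (Tensor.mkHom R N M n) m m'

theorem Tensor.zero_tmul (m : M) : Tensor.tmul R (0 : N) m = 0 :=
  DFunLike.congr_fun (map_zero (Tensor.mkHom R N M)) m

theorem Tensor.sum_tmul {ι : Type*} (s : Finset ι) (n : ι → N) (m : M) :
    Tensor.tmul R (∑ i ∈ s, n i) m = ∑ i ∈ s, Tensor.tmul R (n i) m := by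
  simp only [← Tensor.mkHom_apply, map_sum, AddMonoidHom.finsetSum_apply]

theorem Tensor.tmul_sum {ι : Type*} (s : Finset ι) (n : N) (m : ι → M) :
    Tensor.tmul R n (∑ i ∈ s, m i) = ∑ i ∈ s, Tensor.tmul R n (m i) :=
  map_sum (Tensor.mkHom R N M n) m s

theorem Tensor.induction_on {p : Tensor R N M → Prop} (x : Tensor R N M)
    (tmul : ∀ n m, p (Tensor.tmul R n m)) (add : ∀ x y, p x → p y → p (x + y)) : p x := by
  obtain ⟨x, rfl⟩ := QuotientAddGroup.mk_surjective x
  induction x using TensorProduct.induction_on with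
  | zero =>
    have h := tmul 0 0
    rwa [Tensor.zero_tmul] at h
  | tmul n m => exact tmul n m
  | add x y hx hy => exact add _ _ hx hy

/-- The additive map `N ⊗_R M → A` induced by a balanced biadditive map. -/
def Tensor.lift {A : Type*} [AddCommGroup A] (φ : N →+ M →+ A)
    (hφ : ∀ (n : N) (r : R) (m : M), φ (op r • n) m = φ n (r • m)) : Tensor R N M →+ A :=
  QuotientAddGroup.lift _ (TensorProduct.liftAddHom φ (fun z n m => by simp)) <| by
    rw [AddSubgroup.closure_le]
    rintro _ ⟨n, r, m, rfl⟩
    change TensorProduct.liftAddHom φ _ _ = 0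
    rw [map_sub, TensorProduct.liftAddHom_tmul, TensorProduct.liftAddHom_tmul, hφ, sub_self]

theorem Tensor.map_tmul (f : N →ₗ[Rᵐᵒᵖ] N') (n : N) (m : M) :
    Tensor.map R M f (Tensor.tmul R n m) = Tensor.tmul R (f n) m := rfl

theorem Tensor.map_map (f : N →ₗ[Rᵐᵒᵖ] N') (g : N' →ₗ[Rᵐᵒᵖ] N'') (x : Tensor R N M) :
    Tensor.map R M g (Tensor.map R M f x) = Tensor.map R M (g ∘ₗ f) x := by
  induction x using Tensor.induction_on with
  | tmul n m => rfl
  | add x y hx hy => simp only [map_add, hx, hy]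

theorem Tensor.id_map (x : Tensor R N M) : Tensor.map R M LinearMap.id x = x := by
  induction x using Tensor.induction_on with
  | tmul n m => rfl
  | add x y hx hy => simp only [map_add, hx, hy]

theorem Tensor.add_map (f g : N →ₗ[Rᵐᵒᵖ] N') (x : Tensor R N M) :
    Tensor.map R M (f + g) x = Tensor.map R M f x + Tensor.map R M g x := by
  induction x using Tensor.induction_on with
  | tmul n m => simp only [Tensor.map_tmul, LinearMap.add_apply, Tensor.add_tmul]
  | add x y hx hy => rw [map_add, map_add, map_add, hx, hy]; abel

theorem Tensor.zero_map (x : Tensor R N M) : Tensor.map R M (0 : N →ₗ[Rᵐᵒᵖ] N') x = 0 := by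
  induction x using Tensor.induction_on with
  | tmul n m => simp only [Tensor.map_tmul, LinearMap.zero_apply, Tensor.zero_tmul]
  | add x y hx hy => rw [map_add, hx, hy, add_zero]

theorem Tensor.sum_map {ι : Type*} (s : Finset ι) (f : ι → N →ₗ[Rᵐᵒᵖ] N') (x : Tensor R N M) :
    Tensor.map R M (∑ i ∈ s, f i) x = ∑ i ∈ s, Tensor.map R M (f i) x := by
  classical
  induction s using Finset.induction_on with
  | empty => rw [Finset.sum_empty, Finset.sum_empty, Tensor.zero_map]
  | insert a s ha ih => rw [Finset.sum_insert ha, Finset.sum_insert ha, Tensor.add_map, ih]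

/-- The homomorphism `N ⊗_R g : N ⊗_R M → N ⊗_R M'`. -/
def Tensor.mapRight (N : Type u) [AddCommGroup N] [Module Rᵐᵒᵖ N] (g : M →ₗ[R] M') :
    Tensor R N M →+ Tensor R N M' :=
  QuotientAddGroup.map _ _ (g.toAddMonoidHom.toIntLinearMap.lTensor N).toAddMonoidHom <| by
    rw [AddSubgroup.closure_le]
    rintro _ ⟨n, r, m, rfl⟩
    refine AddSubgroup.subset_closure ⟨n, r, g m, ?_⟩
    simp

theorem Tensor.map_mapRight (f : N →ₗ[Rᵐᵒᵖ] N') (g : M →ₗ[R] M') (x : Tensor R N M) :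
    Tensor.map R M' f (Tensor.mapRight N g x) = Tensor.mapRight N' g (Tensor.map R M f x) := by
  induction x using Tensor.induction_on with
  | tmul n m => rfl
  | add x y hx hy => simp only [map_add, hx, hy]

theorem Tensor.map_surjective {f : N →ₗ[Rᵐᵒᵖ] N'} (hf : Function.Surjective f) :
    Function.Surjective (Tensor.map R M f) := by
  intro x
  induction x using Tensor.induction_on with
  | tmul n m =>
    obtain ⟨n, rfl⟩ := hf n
    exact ⟨Tensor.tmul R n m, rfl⟩
  | add x y hx hy =>
    obtain ⟨x, rfl⟩ := hx
    obtain ⟨y, rfl⟩ := hy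
    exact ⟨x + y, map_add _ x y⟩

theorem Tensor.mapRight_surjective {g : M →ₗ[R] M'} (hg : Function.Surjective g) :
    Function.Surjective (Tensor.mapRight N g) := by
  intro x
  induction x using Tensor.induction_on with
  | tmul n m =>
    obtain ⟨m, rfl⟩ := hg m
    exact ⟨Tensor.tmul R n m, rfl⟩
  | add x y hx hy =>
    obtain ⟨x, rfl⟩ := hx
    obtain ⟨y, rfl⟩ := hy
    exact ⟨x + y, map_add _ x y⟩

theorem Tensor.map_exact (M : Type u) [AddCommGroup M] [Module R M] {f : N →ₗ[Rᵐᵒᵖ] N'}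
    {g : N' →ₗ[Rᵐᵒᵖ] N''} (hfg : Function.Exact f g) (hg : Function.Surjective g) :
    Function.Exact (Tensor.map R M f) (Tensor.map R M g) := by
  refine quotientAddGroup_map_exact (rTensor_exact (R := ℤ) M (f := f.toAddMonoidHom.toIntLinearMap)
    (g := g.toAddMonoidHom.toIntLinearMap) hfg hg) _ _ ?_
  rw [AddSubgroup.closure_le]
  rintro _ ⟨n, r, m, rfl⟩
  obtain ⟨n, rfl⟩ := hg n
  refine ⟨_, AddSubgroup.subset_closure ⟨n, r, m, rfl⟩, ?_⟩
  rw [map_sub]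
  exact congrArg (fun x => x ⊗ₜ[ℤ] m - g n ⊗ₜ[ℤ] (r • m)) (map_smul g (op r) n)

theorem Tensor.mapRight_exact (N : Type u) [AddCommGroup N] [Module Rᵐᵒᵖ N] {f : M →ₗ[R] M'}
    {g : M' →ₗ[R] M''} (hfg : Function.Exact f g) (hg : Function.Surjective g) :
    Function.Exact (Tensor.mapRight N f) (Tensor.mapRight N g) := by
  refine quotientAddGroup_map_exact (lTensor_exact (R := ℤ) N (f := f.toAddMonoidHom.toIntLinearMap)
    (g := g.toAddMonoidHom.toIntLinearMap) hfg hg) _ _ ?_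
  rw [AddSubgroup.closure_le]
  rintro _ ⟨n, r, m, rfl⟩
  obtain ⟨m, rfl⟩ := hg m
  refine ⟨_, AddSubgroup.subset_closure ⟨n, r, m, rfl⟩, ?_⟩
  rw [map_sub]
  exact congrArg (fun x => (op r • n) ⊗ₜ[ℤ] g m - n ⊗ₜ[ℤ] x) (map_smul g r m)

/-- An element of `N ⊗_R M` is a sum `∑ c_j ⊗ m_j` if the `c_j` generate `N`. -/
theorem Tensor.exists_eq_sum {k : ℕ} (c : Fin k → N)
    (hc : ∀ n : N, ∃ a : Fin k → R, n = ∑ j, op (a j) • c j) (x : Tensor R N M) :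
    ∃ m : Fin k → M, x = ∑ j, Tensor.tmul R (c j) (m j) := by
  induction x using Tensor.induction_on with
  | tmul n m =>
    obtain ⟨a, rfl⟩ := hc n
    exact ⟨fun j => a j • m, by simp only [Tensor.sum_tmul, Tensor.smul_tmul]⟩
  | add x y hx hy =>
    obtain ⟨m, rfl⟩ := hx
    obtain ⟨m', rfl⟩ := hy
    exact ⟨fun j => m j + m' j, by simp only [Tensor.tmul_add, Finset.sum_add_distrib]⟩

/-- The isomorphism `R ⊗_R M ≅ M`, as a map. -/
def Tensor.ringHom (R : Type u) [Ring R] (M : Type u) [AddCommGroup M] [Module R M] :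
    Tensor R Rᵐᵒᵖ M →+ M :=
  Tensor.lift (AddMonoidHom.mk' (fun r : Rᵐᵒᵖ => DistribSMul.toAddMonoidHom M (unop r))
    (fun r s => AddMonoidHom.ext fun m => add_smul (unop r) (unop s) m))
    (fun n r m => by
      change (unop (op r • n)) • m = unop n • r • m
      rw [smul_eq_mul, unop_mul, unop_op, mul_smul])

theorem Tensor.ringHom_tmul (r : Rᵐᵒᵖ) (m : M) :
    Tensor.ringHom R M (Tensor.tmul R r m) = unop r • m := rfl

theorem Tensor.eq_one_tmul_ringHom (x : Tensor R Rᵐᵒᵖ M) :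
    x = Tensor.tmul R 1 (Tensor.ringHom R M x) := by
  induction x using Tensor.induction_on with
  | tmul r m =>
    rw [Tensor.ringHom_tmul, ← Tensor.smul_tmul, op_unop, smul_eq_mul, mul_one]
  | add x y hx hy => rw [map_add, Tensor.tmul_add, ← hx, ← hy]

/-- With `Tensor.exists_pi`, this amounts to N^k ⊗ M ≅ (N ⊗ M)^k. Both rest on writing the identity
of N^k as the sum of projections followed by inclusions. -/
theorem Tensor.pi_ext {k : ℕ} {x y : Tensor R (Fin k → N) M}
    (h : ∀ j, Tensor.map R M (LinearMap.proj j) x = Tensor.map R M (LinearMap.proj j) y) :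
    x = y := by
  have key : ∀ z : Tensor R (Fin k → N) M, z = ∑ j, Tensor.map R M
      (LinearMap.single Rᵐᵒᵖ (fun _ => N) j) (Tensor.map R M (LinearMap.proj j) z) := by
    intro z
    simp only [Tensor.map_map]
    rw [← Tensor.sum_map]
    conv_lhs => rw [← Tensor.id_map z]
    congr 1
    congr 1
    refine LinearMap.ext fun v => ?_
    funext i
    simp [Pi.single_apply]
  rw [key x, key y]
  simp only [h]

theorem Tensor.exists_pi {k : ℕ} (y : Fin k → Tensor R N M) :
    ∃ x : Tensor R (Fin k → N) M, ∀ j, Tensor.map R M (LinearMap.proj j) x = y j := by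
  refine ⟨∑ i, Tensor.map R M (LinearMap.single Rᵐᵒᵖ (fun _ => N) i) (y i), fun j => ?_⟩
  rw [map_sum, Finset.sum_eq_single j]
  · rw [Tensor.map_map]
    convert Tensor.id_map (y j) using 2
    refine congrArg _ (LinearMap.ext fun v => ?_)
    simp
  · intro i _ hij
    rw [Tensor.map_map]
    convert Tensor.zero_map (y i) using 2
    refine congrArg _ (LinearMap.ext fun v => ?_)
    simp [hij.symm]
  · simp

/-- The vanishing criterion for `∑ c_j ⊗ m_j` in terms of a presentation. -/
theorem Tensor.vanishing {k l : ℕ} {π : (Fin k → Rᵐᵒᵖ) →ₗ[Rᵐᵒᵖ] N}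
    {σ : (Fin l → Rᵐᵒᵖ) →ₗ[Rᵐᵒᵖ] (Fin k → Rᵐᵒᵖ)} (hπ : Function.Surjective π)
    (hσ : Function.Exact σ π) (m : Fin k → M)
    (h : ∑ j, Tensor.tmul R (π (Pi.single j 1)) (m j) = 0) :
    ∃ y : Fin l → M, ∀ j, m j = ∑ i, unop (σ (Pi.single i 1) j) • y i := by
  have h' : Tensor.map R M π (∑ j, Tensor.tmul R (Pi.single j 1) (m j)) = 0 := by
    rw [map_sum]
    exact h
  obtain ⟨t, ht⟩ := (Tensor.map_exact M hσ hπ _).1 h'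
  obtain ⟨y, rfl⟩ := Tensor.exists_eq_sum (fun i : Fin l => (Pi.single i 1 : Fin l → Rᵐᵒᵖ))
    (fun n => ⟨fun j => unop (n j), by
      funext i
      simp [Finset.sum_apply, Pi.single_apply]⟩) t
  refine ⟨y, fun j => ?_⟩
  -- Read off coordinate j and identify R ⊗ M with M.
  have := congrArg (fun x => Tensor.ringHom R M (Tensor.map R M (LinearMap.proj j) x)) ht
  simpa [map_sum, Tensor.map_tmul, Tensor.ringHom_tmul, Pi.single_apply, apply_ite unop,
    ite_smul] using this.symm

end Tensor

/-! ### Weak flatness as preservation of injectivity. -/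

section WeakFlat

variable {R : Type u} [Ring R]
variable {N : Type u} [AddCommGroup N] [Module Rᵐᵒᵖ N]
variable {F : Type u} [AddCommGroup F] [Module R F]

theorem isZero_tor_one_iff_exact (P : ProjectiveResolution (ModuleCat.of Rᵐᵒᵖ N)) :
    Limits.IsZero (Tor R 1 N F) ↔ Function.Exact (Tensor.map R F (P.complex.d 2 1).hom)
      (Tensor.map R F (P.complex.d 1 0).hom) := by
  rw [Tor, (P.isoLeftDerivedObj (tensorRight R F) 1).isZero_iff]
  refine (HomologicalComplex.exactAt_iff_isZero_homology _ _).symm.trans ?_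
  rw [HomologicalComplex.exactAt_iff' _ 2 1 0 (by simp) (by simp)]
  exact ShortComplex.ab_exact_iff_function_exact _

/-- The differential from degree 1 factors through a surjection onto ker p. By right exactness,
exactness at degree 1 after tensoring says exactly that ker p → P_0 stays injective. -/
theorem isZero_tor_one_iff_injective (P : ProjectiveResolution (ModuleCat.of Rᵐᵒᵖ N))
    {p : P.complex.X 0 →ₗ[Rᵐᵒᵖ] N} (hp : Function.Exact (P.complex.d 1 0).hom p) :
    Limits.IsZero (Tor R 1 N F) ↔
      Function.Injective (Tensor.map R F (LinearMap.ker p).subtype) := by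
  have hmem : ∀ x, (P.complex.d 1 0).hom x ∈ LinearMap.ker p := fun x => (hp _).2 ⟨x, rfl⟩
  let q : P.complex.X 1 →ₗ[Rᵐᵒᵖ] LinearMap.ker p := (P.complex.d 1 0).hom.codRestrict _ hmem
  have hq : Function.Surjective q := by
    rintro ⟨y, hy⟩
    obtain ⟨x, rfl⟩ := (hp y).1 hy
    exact ⟨x, rfl⟩
  have hdq : Function.Exact (P.complex.d 2 1).hom q := by
    intro x
    rw [← (resolution_exact N P).2 0 x, Subtype.ext_iff]
    rfl
  have hd : ∀ x, Tensor.map R F (P.complex.d 1 0).hom x =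
      Tensor.map R F (LinearMap.ker p).subtype (Tensor.map R F q x) := fun x => by
    rw [Tensor.map_map]
    rfl
  have hex := Tensor.map_exact F hdq hq
  rw [isZero_tor_one_iff_exact P]
  constructor
  · intro h
    rw [injective_iff_map_eq_zero]
    intro x hx
    obtain ⟨x, rfl⟩ := Tensor.map_surjective hq x
    rw [← hd] at hx
    exact (hex x).2 ((h x).1 hx)
  · intro h x
    rw [hd, map_eq_zero_iff _ h]
    exact hex x

/-- Y need not be projective. Compare with a resolution through the exact sequence ker p → X ⊕ P_0 →
Y → 0. An element of X ⊗ F dying in Y ⊗ F comes from some k in ker p ⊗ F whose image in P_0 ⊗ F is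
zero, so k = 0 by the vanishing of Tor. -/
theorem WeakFlat.map_injective (hF : WeakFlat R F) (hN : SuperFinitelyPresented Rᵐᵒᵖ N)
    {X Y : Type u} [AddCommGroup X] [Module Rᵐᵒᵖ X] [AddCommGroup Y] [Module Rᵐᵒᵖ Y]
    {f : X →ₗ[Rᵐᵒᵖ] Y} {g : Y →ₗ[Rᵐᵒᵖ] N} (hf : Function.Injective f) (hfg : Function.Exact f g)
    (hg : Function.Surjective g) : Function.Injective (Tensor.map R F f) := by
  obtain ⟨P, -⟩ := id hN
  obtain ⟨⟨p, hp, hdp⟩, -⟩ := resolution_exact N P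
  have hinj := (isZero_tor_one_iff_injective P hdp).1 (hF N hN)
  have : Module.Projective Rᵐᵒᵖ (P.complex.X 0) :=
    (IsProjective.iff_projective (R := Rᵐᵒᵖ) (P.complex.X 0)).2 (P.projective 0)
  obtain ⟨t, ht⟩ := Module.projective_lifting_property g p hg
  have ht' : ∀ x, g (t x) = p x := fun x => LinearMap.congr_fun ht x
  have hgf : ∀ x, g (f x) = 0 := hfg.apply_apply_eq_zero
  have hL : ∀ x : LinearMap.ker p, ∃ y, f y = t x := fun x => (hfg _).1 ((ht' x).trans x.2)
  let e := LinearEquiv.ofInjective f hf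
  let s : LinearMap.ker p →ₗ[Rᵐᵒᵖ] X := e.symm.toLinearMap ∘ₗ
    (t ∘ₗ (LinearMap.ker p).subtype).codRestrict (LinearMap.range f) hL
  have hs : ∀ x, f (s x) = t x := fun x => congrArg Subtype.val (e.apply_symm_apply ⟨t x, hL x⟩)
  -- On ker p the maps t and f ∘ s agree, so the minus sign makes the range of `a` the kernel of
  -- `b`.
  let a : LinearMap.ker p →ₗ[Rᵐᵒᵖ] X × P.complex.X 0 := s.prod (-(LinearMap.ker p).subtype)
  let b : X × P.complex.X 0 →ₗ[Rᵐᵒᵖ] Y := f.coprod t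
  have hb : ∀ x y, b (x, y) = f x + t y := fun _ _ => rfl
  have hbs : Function.Surjective b := by
    intro y
    obtain ⟨z, hz⟩ := hp (g y)
    obtain ⟨x, hx⟩ := (hfg (y - t z)).1 (by rw [map_sub, ht', hz, sub_self])
    exact ⟨(x, z), by rw [hb, hx, sub_add_cancel]⟩
  have hab : Function.Exact a b := by
    rintro ⟨x, y⟩
    constructor
    · intro h
      rw [hb] at h
      have hy : -y ∈ LinearMap.ker p := by
        have h' := congrArg g h
        rw [map_add, hgf, zero_add, ht', map_zero] at h'
        rw [LinearMap.mem_ker, map_neg, h', neg_zero]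
      refine ⟨⟨-y, hy⟩, Prod.ext (hf ?_) (neg_neg y)⟩
      refine (hs _).trans ?_
      rw [map_neg]
      exact (eq_neg_of_add_eq_zero_left h).symm
    · rintro ⟨z, hz⟩
      rw [← hz]
      change f (s z) + t (-z) = 0
      rw [hs, map_neg, add_neg_cancel]
  rw [injective_iff_map_eq_zero]
  intro x hx
  have hx' : Tensor.map R F b (Tensor.map R F (LinearMap.inl _ _ _) x) = 0 := by
    rw [Tensor.map_map, LinearMap.coprod_inl, hx]
  obtain ⟨k, hk⟩ := (Tensor.map_exact F hab hbs _).1 hx'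
  have h₂ := congrArg (Tensor.map R F (LinearMap.snd _ _ _)) hk
  have h₁ := congrArg (Tensor.map R F (LinearMap.fst _ _ _)) hk
  rw [Tensor.map_map, Tensor.map_map, LinearMap.snd_comp_inl, Tensor.zero_map,
    LinearMap.snd_prod] at h₂
  rw [Tensor.map_map, Tensor.map_map, LinearMap.fst_comp_inl, Tensor.id_map] at h₁
  have hk₀ : k = 0 := by
    refine hinj (Eq.trans ?_ (map_zero _).symm)
    have h₃ := Tensor.add_map (LinearMap.ker p).subtype (-(LinearMap.ker p).subtype) k
    rw [h₂, add_zero, add_neg_cancel, Tensor.zero_map] at h₃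
    exact h₃.symm
  rw [← h₁, hk₀, map_zero]

/-- One resolution suffices to test Tor, so K may be taken to be its first syzygy, presented by the
terms in degrees 1 and 2. -/
theorem weakFlat_of_map_injective
    (h : ∀ (N P K : Type u) [AddCommGroup N] [Module Rᵐᵒᵖ N] [AddCommGroup P] [Module Rᵐᵒᵖ P]
      [AddCommGroup K] [Module Rᵐᵒᵖ K] (i : K →ₗ[Rᵐᵒᵖ] P) (p : P →ₗ[Rᵐᵒᵖ] N),
      SuperFinitelyPresented Rᵐᵒᵖ N → Module.FinitePresentation Rᵐᵒᵖ K →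
      Function.Injective i → Function.Exact i p → Function.Surjective p →
      Function.Injective (Tensor.map R F i)) : WeakFlat R F := by
  rintro N _ _ hN
  obtain ⟨P, hfin⟩ := id hN
  obtain ⟨⟨p, hp, hdp⟩, hd⟩ := resolution_exact N P
  refine (isZero_tor_one_iff_injective P hdp).2 (h N _ _ _ p hN ?_ Subtype.val_injective
    (LinearMap.exact_subtype_ker_map p) hp)
  have hmem : ∀ x, (P.complex.d 1 0).hom x ∈ LinearMap.ker p := fun x => (hdp _).2 ⟨x, rfl⟩
  let q : P.complex.X 1 →ₗ[Rᵐᵒᵖ] LinearMap.ker p := (P.complex.d 1 0).hom.codRestrict _ hmem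
  have hq : Function.Surjective q := by
    rintro ⟨y, hy⟩
    obtain ⟨x, rfl⟩ := (hdp y).1 hy
    exact ⟨x, rfl⟩
  have hdq : Function.Exact (P.complex.d 2 1).hom q := by
    intro x
    rw [← hd 0 x, Subtype.ext_iff]
    rfl
  have := hfin 1
  have := hfin 2
  have : Module.Projective Rᵐᵒᵖ (P.complex.X 1) :=
    (IsProjective.iff_projective (R := Rᵐᵒᵖ) (P.complex.X 1)).2 (P.projective 1)
  have := Module.finitePresentation_of_projective Rᵐᵒᵖ (P.complex.X 1)
  refine Module.finitePresentation_of_surjective q hq ?_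
  rw [LinearMap.exact_iff.1 hdq, LinearMap.range_eq_map]
  exact (Module.Finite.iff_fg.1 (inferInstance : Module.Finite _ (⊤ : Submodule _ _))).map _

end WeakFlat

/-! ### Factoring homomorphisms; generators and relations. -/

theorem exists_factor_of_surjective {R : Type*} [Ring R] {A B D : Type*} [AddCommGroup A]
    [Module R A] [AddCommGroup B] [Module R B] [AddCommGroup D] [Module R D] {p : A →ₗ[R] B}
    (hp : Function.Surjective p) {φ : A →ₗ[R] D} (h : ∀ x, p x = 0 → φ x = 0) :
    ∃ ψ : B →ₗ[R] D, ∀ x, ψ (p x) = φ x := by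
  refine ⟨(LinearMap.ker p).liftQ φ h ∘ₗ (p.quotKerEquivOfSurjective hp).symm.toLinearMap,
    fun x => ?_⟩
  have : (p.quotKerEquivOfSurjective hp).symm (p x) = (LinearMap.ker p).mkQ x := by
    rw [LinearEquiv.symm_apply_eq]
    rfl
  rw [LinearMap.comp_apply, LinearEquiv.coe_coe, this]
  rfl

theorem exists_factor_of_injective {R : Type*} [Ring R] {A B D : Type*} [AddCommGroup A]
    [Module R A] [AddCommGroup B] [Module R B] [AddCommGroup D] [Module R D] {f : A →ₗ[R] B}
    (hf : Function.Injective f) {φ : D →ₗ[R] B} (h : ∀ x, ∃ a, f a = φ x) :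
    ∃ ψ : D →ₗ[R] A, ∀ x, f (ψ x) = φ x := by
  let e := LinearEquiv.ofInjective f hf
  exact ⟨e.symm.toLinearMap ∘ₗ φ.codRestrict (LinearMap.range f) h,
    fun x => congrArg Subtype.val (e.apply_symm_apply ⟨φ x, h x⟩)⟩

theorem exists_generators_relations (R P : Type u) [Ring R] [AddCommGroup P] [Module R P]
    [Module.FinitePresentation R P] : ∃ (k l : ℕ) (c : Fin k → P) (r : Fin l → Fin k → R),
      (∀ x, ∃ a : Fin k → R, x = ∑ j, a j • c j) ∧ (∀ i, ∑ j, r i j • c j = 0) ∧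
      ∀ (D : Type u) [AddCommGroup D] [Module R D] (d : Fin k → D),
        (∀ i, ∑ j, r i j • d j = 0) → ∃ φ : P →ₗ[R] D, ∀ j, φ (c j) = d j := by
  obtain ⟨k, l, π, σ, hπ, hσ⟩ := Module.FinitePresentation.exists_fin' R P
  have hdecomp : ∀ v : Fin k → R, v = ∑ j, v j • Pi.single j (1 : R) := by
    intro v
    funext j
    simp [Finset.sum_apply, Pi.single_apply]
  refine ⟨k, l, fun j => π (Pi.single j 1), fun i => σ (Pi.single i 1), fun x => ?_, fun i => ?_,
    fun D _ _ d hd => ?_⟩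
  · obtain ⟨v, rfl⟩ := hπ x
    exact ⟨v, (congrArg π (hdecomp v)).trans (by simp only [map_sum, map_smul])⟩
  · simp only [← map_smul, ← map_sum]
    rw [← hdecomp, hσ.apply_apply_eq_zero]
  · obtain ⟨φ, hφ⟩ := exists_factor_of_surjective hπ (φ := Fintype.linearCombination R d) (by
      intro x hx
      obtain ⟨y, rfl⟩ := (hσ x).1 hx
      have : Fintype.linearCombination R d ∘ₗ σ = 0 :=
        LinearMap.pi_ext' fun i => LinearMap.ext_ring (hd i)
      exact LinearMap.congr_fun this y)
    exact ⟨φ, fun j => by rw [hφ, Fintype.linearCombination_apply_single, one_smul]⟩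

/-! ### Purity through linear systems, and pure closure of weak flat modules. -/

section Pure

variable {R : Type u} [Ring R]
variable {A B D : Type u} [AddCommGroup A] [Module R A] [AddCommGroup B] [Module R B]
  [AddCommGroup D] [Module R D]

/-- Purity of `0 → A → B → D → 0` in terms of finite systems of linear equations. -/
structure SystemPure (f : A →ₗ[R] B) (g : B →ₗ[R] D) : Prop where
  injective : Function.Injective f
  exact : Function.Exact f g
  surjective : Function.Surjective g
  lift : ∀ (k l : ℕ) (r : Fin l → Fin k → R) (d : Fin k → D), (∀ i, ∑ j, r i j • d j = 0) →
    ∃ b : Fin k → B, (∀ j, g (b j) = d j) ∧ ∀ i, ∑ j, r i j • b j = 0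

theorem PureExact.systemPure {f : A →ₗ[R] B} {g : B →ₗ[R] D} (h : PureExact R f g) :
    SystemPure f g where
  injective := h.injective
  exact := h.exact
  surjective := h.surjective
  lift k l r d hd := by
    -- A solution of the system in D is a homomorphism R^k / T → D, where T is spanned by the rows;
    -- this quotient is finitely presented, so purity applies.
    let T : Submodule R (Fin k → R) := Submodule.span R (Set.range r)
    have hT : T ≤ LinearMap.ker (Fintype.linearCombination R d) := by
      rw [Submodule.span_le]
      rintro _ ⟨i, rfl⟩
      exact hd i
    have hfp : Module.FinitePresentation R ((Fin k → R) ⧸ T) := by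
      refine Module.finitePresentation_of_surjective T.mkQ T.mkQ_surjective ?_
      rw [Submodule.ker_mkQ]
      exact Submodule.fg_span (Set.finite_range r)
    obtain ⟨s, hs⟩ := h.lift _ hfp (T.liftQ _ hT)
    refine ⟨fun j => s (T.mkQ (Pi.single j 1)), fun j => ?_, fun i => ?_⟩
    · refine (LinearMap.congr_fun hs _).trans ?_
      change Fintype.linearCombination R d (Pi.single j 1) = d j
      rw [Fintype.linearCombination_apply_single, one_smul]
    · have : ∑ j, r i j • (Pi.single j 1 : Fin k → R) = r i := by
        funext j
        simp [Finset.sum_apply, Pi.single_apply]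
      simp only [← map_smul, ← map_sum]
      rw [this, Submodule.mkQ_apply, (Submodule.Quotient.mk_eq_zero T).2
        (Submodule.subset_span ⟨i, rfl⟩), map_zero]

theorem SystemPure.exists_lift {f : A →ₗ[R] B} {g : B →ₗ[R] D} (h : SystemPure f g)
    {P : Type u} [AddCommGroup P] [Module R P] [Module.FinitePresentation R P] (φ : P →ₗ[R] D) :
    ∃ ψ : P →ₗ[R] B, ∀ x, g (ψ x) = φ x := by
  obtain ⟨k, l, c, r, hc, hrc, hdesc⟩ := exists_generators_relations R P
  obtain ⟨b, hb, hrb⟩ := h.lift k l r (fun j => φ (c j)) (fun i => by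
    simp only [← map_smul, ← map_sum]
    rw [hrc, map_zero])
  obtain ⟨ψ, hψ⟩ := hdesc B b hrb
  refine ⟨ψ, fun x => ?_⟩
  obtain ⟨a, rfl⟩ := hc x
  simp only [map_sum, map_smul, hψ, hb]

/-- A finite system of equations over `A` that is solvable in `B` is solvable in `A`. -/
theorem SystemPure.exists_solution {f : A →ₗ[R] B} {g : B →ₗ[R] D} (h : SystemPure f g)
    {k l : ℕ} (r : Fin l → Fin k → R) (a : Fin l → A) (b : Fin k → B)
    (hab : ∀ i, f (a i) = ∑ j, r i j • b j) : ∃ a' : Fin k → A, ∀ i, a i = ∑ j, r i j • a' j := by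
  obtain ⟨c, hc, hrc⟩ := h.lift k l r (fun j => g (b j)) (fun i => by
    simp only [← map_smul, ← map_sum]
    rw [← hab, h.exact.apply_apply_eq_zero])
  have : ∀ j, ∃ x, f x = b j - c j := fun j => (h.exact _).1 (by rw [map_sub, hc, sub_self])
  choose a' ha' using this
  refine ⟨a', fun i => h.injective ?_⟩
  simp only [map_sum, map_smul, ha', smul_sub, Finset.sum_sub_distrib, hrc, sub_zero, hab]

/-- By the vanishing criterion, a tensor dies in N ⊗ B exactly when a finite linear system with
constants from A is solvable in B. Purity moves the solution into A, where it kills the tensor in N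
⊗ A. -/
theorem SystemPure.mapRight_injective {f : A →ₗ[R] B} {g : B →ₗ[R] D} (h : SystemPure f g)
    (N : Type u) [AddCommGroup N] [Module Rᵐᵒᵖ N] [Module.FinitePresentation Rᵐᵒᵖ N] :
    Function.Injective (Tensor.mapRight N f) := by
  obtain ⟨k, l, π, σ, hπ, hσ⟩ := Module.FinitePresentation.exists_fin' Rᵐᵒᵖ N
  have hgen : ∀ n : N, ∃ a : Fin k → R, n = ∑ j, op (a j) • π (Pi.single j 1) := by
    intro n
    obtain ⟨v, rfl⟩ := hπ n
    refine ⟨fun j => unop (v j), ?_⟩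
    simp only [op_unop, ← map_smul, ← map_sum]
    congr 1
    funext j
    simp [Finset.sum_apply, Pi.single_apply]
  rw [injective_iff_map_eq_zero]
  intro x hx
  obtain ⟨m, rfl⟩ := Tensor.exists_eq_sum _ hgen x
  rw [map_sum] at hx
  obtain ⟨y, hy⟩ := Tensor.vanishing hπ hσ (fun j => f (m j)) hx
  obtain ⟨y', hy'⟩ := h.exists_solution (fun j i => unop (σ (Pi.single i 1) j)) m y hy
  simp only [hy', Tensor.tmul_sum, ← Tensor.smul_tmul, op_unop]
  rw [Finset.sum_comm]
  refine Finset.sum_eq_zero fun i _ => ?_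
  rw [← Tensor.sum_tmul]
  simp only [← map_smul, ← map_sum]
  have : ∑ j, σ (Pi.single i 1) j • (Pi.single j 1 : Fin k → Rᵐᵒᵖ) = σ (Pi.single i 1) := by
    funext j
    simp [Finset.sum_apply, Pi.single_apply]
  rw [this, hσ.apply_apply_eq_zero, Tensor.zero_tmul]

/-- An isomorphism is a pure embedding with zero cokernel, so closure under pure submodules also
gives invariance under isomorphism. -/
theorem SystemPure.of_equiv (e : A ≃ₗ[R] B) :
    SystemPure e.toLinearMap (0 : B →ₗ[R] PUnit.{u + 1}) where
  injective := e.injective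
  exact b := ⟨fun _ => ⟨e.symm b, e.apply_symm_apply b⟩, fun _ => rfl⟩
  surjective _ := ⟨0, rfl⟩
  lift k l r d _ := ⟨0, fun _ => rfl, fun i => by simp⟩

theorem SystemPure.weakFlat_left {f : A →ₗ[R] B} {g : B →ₗ[R] D} (h : SystemPure f g)
    (hB : WeakFlat R B) : WeakFlat R A := by
  refine weakFlat_of_map_injective fun N P K _ _ _ _ _ _ i p hN hK hi hip hp => ?_
  refine Function.Injective.of_comp (f := Tensor.mapRight P f) ?_
  have : Tensor.mapRight P f ∘ Tensor.map R A i = Tensor.map R B i ∘ Tensor.mapRight K f :=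
    funext fun x => (Tensor.map_mapRight i f x).symm
  rw [this]
  exact (hB.map_injective hN hi hip hp).comp (h.mapRight_injective K)

/-- A chase in the square of tensor products with K → P → N and A → B → D. Purity makes N ⊗ A → N ⊗
B injective, and weak flatness of B makes K ⊗ B → P ⊗ B injective. -/
theorem SystemPure.weakFlat_right {f : A →ₗ[R] B} {g : B →ₗ[R] D} (h : SystemPure f g)
    (hB : WeakFlat R B) : WeakFlat R D := by
  refine weakFlat_of_map_injective fun N P K _ _ _ _ _ _ i p hN hK hi hip hp => ?_
  have := hN.finitePresentation
  rw [injective_iff_map_eq_zero]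
  intro x hx
  obtain ⟨y, rfl⟩ := Tensor.mapRight_surjective h.surjective x
  rw [Tensor.map_mapRight] at hx
  obtain ⟨z, hz⟩ := (Tensor.mapRight_exact P h.exact h.surjective _).1 hx
  have hpz : Tensor.map R A p z = 0 := by
    refine h.mapRight_injective N ?_
    rw [← Tensor.map_mapRight, hz, map_zero]
    exact (Tensor.map_exact B hip hp).apply_apply_eq_zero y
  obtain ⟨w, rfl⟩ := (Tensor.map_exact A hip hp z).1 hpz
  rw [← Tensor.map_mapRight] at hz
  rw [← hB.map_injective hN hi hip hp hz]
  exact (Tensor.mapRight_exact K h.exact h.surjective).apply_apply_eq_zero w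

end Pure

/-! ### Weak injectivity as extension of homomorphisms, and its pure closure. -/

section WeakInjective

variable {R : Type u} [Ring R]
variable {X Y N I : Type u} [AddCommGroup X] [Module R X] [AddCommGroup Y] [Module R Y]
  [AddCommGroup N] [Module R N] [AddCommGroup I] [Module R I]

theorem moduleCat_shortExact {f : X →ₗ[R] Y} {g : Y →ₗ[R] N} (hf : Function.Injective f)
    (hfg : Function.Exact f g) (hg : Function.Surjective g) :
    (ShortComplex.mk (ModuleCat.ofHom f) (ModuleCat.ofHom g)
      (ModuleCat.hom_ext hfg.linearMap_comp_eq_zero)).ShortExact where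
  exact := (moduleCat_exact_iff _ _ _).2 hfg
  mono_f := (ModuleCat.mono_iff_injective _).2 hf
  epi_g := (ModuleCat.epi_iff_surjective _).2 hg

theorem WeakInjective.exists_extension (hI : WeakInjective R I)
    (hN : SuperFinitelyPresented R N) {f : X →ₗ[R] Y} {g : Y →ₗ[R] N}
    (hf : Function.Injective f) (hfg : Function.Exact f g) (hg : Function.Surjective g)
    (φ : X →ₗ[R] I) : ∃ ψ : Y →ₗ[R] I, ∀ x, ψ (f x) = φ x := by
  have : Subsingleton (Abelian.Ext.{u} (ModuleCat.of R N) (ModuleCat.of R I) 1) := hI N hN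
  obtain ⟨ψ, hψ⟩ := Abelian.Ext.contravariant_sequence_exact₁ (moduleCat_shortExact hf hfg hg)
    (ModuleCat.of R I) (Abelian.Ext.mk₀ (ModuleCat.ofHom φ)) (add_zero 1)
    (Subsingleton.elim (α := Abelian.Ext.{u} (ModuleCat.of R N) (ModuleCat.of R I) 1) _ _)
  obtain ⟨ψ, rfl⟩ := Abelian.Ext.mk₀_bijective _ _ |>.2 ψ
  rw [Abelian.Ext.mk₀_comp_mk₀] at hψ
  have h := (Abelian.Ext.mk₀_bijective _ _).1 hψ
  exact ⟨ψ.hom, fun x => LinearMap.congr_fun (congrArg ModuleCat.Hom.hom h) x⟩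

theorem weakInjective_of_exists_extension
    (h : ∀ (N P K : Type u) [AddCommGroup N] [Module R N] [AddCommGroup P] [Module R P]
      [AddCommGroup K] [Module R K] (i : K →ₗ[R] P) (p : P →ₗ[R] N) (φ : K →ₗ[R] I),
      SuperFinitelyPresented R N → SuperFinitelyPresented R K →
      Function.Injective i → Function.Exact i p → Function.Surjective p →
      ∃ ψ : P →ₗ[R] I, ∀ x, ψ (i x) = φ x) : WeakInjective R I := by
  intro N _ _ hN
  obtain ⟨P, K, _, _, _, _, i, p, _, _, hK, hi, hip, hp⟩ := hN.exists_syzygy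
  have hproj : Projective (ModuleCat.of R P) := (IsProjective.iff_projective (R := R) P).1 ‹_›
  have hS := moduleCat_shortExact hi hip hp
  refine subsingleton_of_forall_eq (0 : Abelian.Ext.{u} (ModuleCat.of R N) (ModuleCat.of R I) 1)
    fun x => ?_
  obtain ⟨y, rfl⟩ := Abelian.Ext.contravariant_sequence_exact₃ hS (ModuleCat.of R I) x
    (Abelian.Ext.eq_zero_of_projective (P := ModuleCat.of R P) _) (add_zero 1)
  obtain ⟨φ, rfl⟩ := Abelian.Ext.mk₀_bijective _ _ |>.2 y
  obtain ⟨ψ, hψ⟩ := h N P K i p φ.hom hN hK hi hip hp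
  have hφ : φ = ModuleCat.ofHom i ≫ ModuleCat.ofHom ψ :=
    ModuleCat.hom_ext (LinearMap.ext fun x => (hψ x).symm)
  rw [hφ, ← Abelian.Ext.mk₀_comp_mk₀]
  exact hS.extClass_comp_assoc _

variable {A B D : Type u} [AddCommGroup A] [Module R A] [AddCommGroup B] [Module R B]
  [AddCommGroup D] [Module R D]

/-- Extend f ∘ φ to ψ : P → B. Modulo A it induces N → D, which lifts to θ : N → B since N is
finitely presented. Then ψ - θ ∘ p lands in A and still extends φ. -/
theorem SystemPure.weakInjective_left {f : A →ₗ[R] B} {g : B →ₗ[R] D} (h : SystemPure f g)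
    (hB : WeakInjective R B) : WeakInjective R A := by
  refine weakInjective_of_exists_extension fun N P K _ _ _ _ _ _ i p φ hN hK hi hip hp => ?_
  have := hN.finitePresentation
  have hgf : ∀ x, g (f x) = 0 := h.exact.apply_apply_eq_zero
  obtain ⟨ψ, hψ⟩ := hB.exists_extension hN hi hip hp (f ∘ₗ φ)
  obtain ⟨χ, hχ⟩ := exists_factor_of_surjective hp (φ := g ∘ₗ ψ) (fun x hx => by
    obtain ⟨y, rfl⟩ := (hip x).1 hx
    rw [LinearMap.comp_apply, hψ, LinearMap.comp_apply, hgf])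
  obtain ⟨θ, hθ⟩ := h.exists_lift χ
  obtain ⟨ω, hω⟩ := exists_factor_of_injective h.injective (φ := ψ - θ ∘ₗ p) (fun x =>
    (h.exact _).1 (by
      rw [LinearMap.sub_apply, map_sub, LinearMap.comp_apply, hθ, hχ, LinearMap.comp_apply,
        sub_self]))
  refine ⟨ω, fun x => h.injective ?_⟩
  rw [hω, LinearMap.sub_apply, hψ, LinearMap.comp_apply, LinearMap.comp_apply,
    hip.apply_apply_eq_zero, map_zero, sub_zero]

/-- The syzygy K is finitely presented, so K → D lifts to B, extends to P there, and is pushed back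
to D. -/
theorem SystemPure.weakInjective_right {f : A →ₗ[R] B} {g : B →ₗ[R] D} (h : SystemPure f g)
    (hB : WeakInjective R B) : WeakInjective R D := by
  refine weakInjective_of_exists_extension fun N P K _ _ _ _ _ _ i p φ hN hK hi hip hp => ?_
  have := hK.finitePresentation
  obtain ⟨θ, hθ⟩ := h.exists_lift φ
  obtain ⟨ψ, hψ⟩ := hB.exists_extension hN hi hip hp θ
  exact ⟨g ∘ₗ ψ, fun x => by rw [LinearMap.comp_apply, hψ, hθ]⟩

end WeakInjective

/-! ### Exactness on left exact sequences of super finitely presented modules. -/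

section Exactness

variable {R : Type u} [Ring R]

/-- Split 0 → X → Y → Z at Q = Y / ker g. Both Q and Z / Q are super finitely presented by the
cokernel lemma, so Tor vanishing applies to each short exact piece. -/
theorem WeakFlat.map_injective_and_exact {F : Type u} [AddCommGroup F] [Module R F]
    (hF : WeakFlat R F) {X Y Z : Type u} [AddCommGroup X] [Module Rᵐᵒᵖ X] [AddCommGroup Y]
    [Module Rᵐᵒᵖ Y] [AddCommGroup Z] [Module Rᵐᵒᵖ Z] (hX : SuperFinitelyPresented Rᵐᵒᵖ X)
    (hY : SuperFinitelyPresented Rᵐᵒᵖ Y) (hZ : SuperFinitelyPresented Rᵐᵒᵖ Z)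
    {f : X →ₗ[Rᵐᵒᵖ] Y} {g : Y →ₗ[Rᵐᵒᵖ] Z} (hf : Function.Injective f) (hfg : Function.Exact f g) :
    Function.Injective (Tensor.map R F f) ∧
      Function.Exact (Tensor.map R F f) (Tensor.map R F g) := by
  let q := (LinearMap.ker g).mkQ
  have hfq : Function.Exact f q := by
    intro x
    rw [← hfg x, Submodule.mkQ_apply, Submodule.Quotient.mk_eq_zero, LinearMap.mem_ker]
  have hq : Function.Surjective q := (LinearMap.ker g).mkQ_surjective
  have hQ := hX.cokernel hY f q hf hfq hq
  let γ : (Y ⧸ LinearMap.ker g) →ₗ[Rᵐᵒᵖ] Z := (LinearMap.ker g).liftQ g le_rfl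
  have hγ : Function.Injective γ := LinearMap.ker_eq_bot.1 (Submodule.ker_liftQ_eq_bot' _ _ rfl)
  have hγp := γ.exact_map_mkQ_range
  have hW := hQ.cokernel hZ γ _ hγ hγp (Submodule.mkQ_surjective _)
  refine ⟨hF.map_injective hQ hf hfq hq, fun x => ?_⟩
  rw [← Tensor.map_exact F hfq hq x,
    ← map_eq_zero_iff _ (hF.map_injective hW hγ hγp (Submodule.mkQ_surjective _)), Tensor.map_map]
  rfl

/-- The same splitting, with extension of homomorphisms in place of injectivity after tensoring. -/
theorem WeakInjective.exists_extension_and_exact {I : Type u} [AddCommGroup I] [Module R I]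
    (hI : WeakInjective R I) {X Y Z : Type u} [AddCommGroup X] [Module R X] [AddCommGroup Y]
    [Module R Y] [AddCommGroup Z] [Module R Z] (hX : SuperFinitelyPresented R X)
    (hY : SuperFinitelyPresented R Y) (hZ : SuperFinitelyPresented R Z)
    {f : X →ₗ[R] Y} {g : Y →ₗ[R] Z} (hf : Function.Injective f) (hfg : Function.Exact f g) :
    (∀ φ : X →ₗ[R] I, ∃ ψ : Y →ₗ[R] I, ∀ x, ψ (f x) = φ x) ∧
      ∀ ψ : Y →ₗ[R] I, (∀ x, ψ (f x) = 0) → ∃ χ : Z →ₗ[R] I, ∀ y, χ (g y) = ψ y := by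
  let q := (LinearMap.ker g).mkQ
  have hfq : Function.Exact f q := by
    intro x
    rw [← hfg x, Submodule.mkQ_apply, Submodule.Quotient.mk_eq_zero, LinearMap.mem_ker]
  have hq : Function.Surjective q := (LinearMap.ker g).mkQ_surjective
  have hQ := hX.cokernel hY f q hf hfq hq
  let γ : (Y ⧸ LinearMap.ker g) →ₗ[R] Z := (LinearMap.ker g).liftQ g le_rfl
  have hγ : Function.Injective γ := LinearMap.ker_eq_bot.1 (Submodule.ker_liftQ_eq_bot' _ _ rfl)
  have hγp := γ.exact_map_mkQ_range
  have hW := hQ.cokernel hZ γ _ hγ hγp (Submodule.mkQ_surjective _)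
  refine ⟨hI.exists_extension hQ hf hfq hq, fun ψ hψ => ?_⟩
  obtain ⟨θ, hθ⟩ := exists_factor_of_surjective hq (φ := ψ) (fun x hx => by
    obtain ⟨y, rfl⟩ := (hfq x).1 hx
    exact hψ y)
  obtain ⟨χ, hχ⟩ := hI.exists_extension hW hγ hγp (Submodule.mkQ_surjective _) θ
  exact ⟨χ, fun y => (hχ (q y)).trans (hθ y)⟩

end Exactness

/-! ### The adjunction attached to C, and its effect on purity. -/

section Bimodule

variable {S R : Type u} [Ring S] [Ring R]
variable {C : Type u} [AddCommGroup C] [Module S C] [Module Rᵐᵒᵖ C] [SMulCommClass S Rᵐᵒᵖ C]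
variable {M M' M'' : Type u} [AddCommGroup M] [Module R M] [AddCommGroup M'] [Module R M']
  [AddCommGroup M''] [Module R M'']
variable {I I' I'' : Type u} [AddCommGroup I] [Module S I] [AddCommGroup I'] [Module S I']
  [AddCommGroup I''] [Module S I'']

/-- Multiplication by `s` on the left, as a homomorphism of right modules. -/
def leftMul (R : Type u) [Ring R] (C : Type u) [AddCommGroup C] [Module S C] [Module Rᵐᵒᵖ C]
    [SMulCommClass S Rᵐᵒᵖ C] (s : S) : C →ₗ[Rᵐᵒᵖ] C where
  toFun c := s • c
  map_add' := smul_add s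
  map_smul' r c := smul_comm s r c

/-- Multiplication by `r` on the right, as a homomorphism of left modules. -/
def rightMul (S : Type u) [Ring S] (C : Type u) [AddCommGroup C] [Module S C] [Module Rᵐᵒᵖ C]
    [SMulCommClass S Rᵐᵒᵖ C] (r : Rᵐᵒᵖ) : C →ₗ[S] C where
  toFun c := r • c
  map_add' := smul_add r
  map_smul' s c := (smul_comm s r c).symm

/-- The homomorphism `C^k → C^l` of right modules given by a matrix over `S`. -/
def leftMatrix (R : Type u) [Ring R] (C : Type u) [AddCommGroup C] [Module S C] [Module Rᵐᵒᵖ C]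
    [SMulCommClass S Rᵐᵒᵖ C] {k l : ℕ} (s : Fin l → Fin k → S) :
    (Fin k → C) →ₗ[Rᵐᵒᵖ] (Fin l → C) :=
  LinearMap.pi fun i => ∑ j, leftMul R C (s i j) ∘ₗ LinearMap.proj j

theorem leftMatrix_apply {k l : ℕ} (s : Fin l → Fin k → S) (x : Fin k → C) (i : Fin l) :
    leftMatrix R C s x i = ∑ j, s i j • x j := by
  simp [leftMatrix, leftMul]

/-- The homomorphism `C^k → C^l` of left modules given by a matrix over `Rᵐᵒᵖ`. -/
def rightMatrix (S : Type u) [Ring S] (C : Type u) [AddCommGroup C] [Module S C] [Module Rᵐᵒᵖ C]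
    [SMulCommClass S Rᵐᵒᵖ C] {k l : ℕ} (r : Fin l → Fin k → Rᵐᵒᵖ) :
    (Fin k → C) →ₗ[S] (Fin l → C) :=
  LinearMap.pi fun i => ∑ j, rightMul S C (r i j) ∘ₗ LinearMap.proj j

theorem rightMatrix_apply {k l : ℕ} (r : Fin l → Fin k → Rᵐᵒᵖ) (x : Fin k → C) (i : Fin l) :
    rightMatrix S C r x i = ∑ j, r i j • x j := by
  simp [rightMatrix, rightMul]

/-! ### The left `S`-module `C ⊗_R M` -/

/-- The identification of `Tensor R C M` with the additive group of `BimoduleTensor S R C M`. -/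
def tensorEquiv (S R : Type u) [Ring S] [Ring R] (C : Type u) [AddCommGroup C] [Module S C]
    [Module Rᵐᵒᵖ C] [SMulCommClass S Rᵐᵒᵖ C] (M : Type u) [AddCommGroup M] [Module R M] :
    Tensor R C M ≃+ BimoduleTensor S R C M where
  toFun x := x
  invFun x := x
  left_inv _ := rfl
  right_inv _ := rfl
  map_add' x y := by
    obtain ⟨x, rfl⟩ := QuotientAddGroup.mk_surjective x
    obtain ⟨y, rfl⟩ := QuotientAddGroup.mk_surjective y
    rfl

theorem smul_tensorEquiv (s : S) (x : Tensor R C M) :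
    s • tensorEquiv S R C M x = tensorEquiv S R C M (Tensor.map R M (leftMul R C s) x) := by
  induction x using Tensor.induction_on with
  | tmul n m => rfl
  | add x y hx hy => simp only [map_add, smul_add, hx, hy]

theorem tensorEquiv_proj_leftMatrix {k l : ℕ} (s : Fin l → Fin k → S)
    (x : Tensor R (Fin k → C) M) (i : Fin l) :
    tensorEquiv S R C M (Tensor.map R M (LinearMap.proj i) (Tensor.map R M (leftMatrix R C s) x)) =
      ∑ j, s i j • tensorEquiv S R C M (Tensor.map R M (LinearMap.proj j) x) := by
  simp only [smul_tensorEquiv, Tensor.map_map, ← map_sum]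
  rw [← Tensor.sum_map]
  rfl

/-- The `S`-linear map `C ⊗_R g`. -/
def BimoduleTensor.map (S : Type u) [Ring S] (C : Type u) [AddCommGroup C] [Module S C]
    [Module Rᵐᵒᵖ C] [SMulCommClass S Rᵐᵒᵖ C] (g : M →ₗ[R] M') :
    BimoduleTensor S R C M →ₗ[S] BimoduleTensor S R C M' where
  toFun x := tensorEquiv S R C M' (Tensor.mapRight C g ((tensorEquiv S R C M).symm x))
  map_add' x y := by simp only [map_add]
  map_smul' s x := by
    obtain ⟨x, rfl⟩ := (tensorEquiv S R C M).surjective x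
    simp only [smul_tensorEquiv, AddEquiv.symm_apply_apply, Tensor.map_mapRight, RingHom.id_apply]

theorem BimoduleTensor.map_tensorEquiv (g : M →ₗ[R] M') (x : Tensor R C M) :
    BimoduleTensor.map S C g (tensorEquiv S R C M x) =
      tensorEquiv S R C M' (Tensor.mapRight C g x) := rfl

theorem BimoduleTensor.map_exact {f : M →ₗ[R] M'} {g : M' →ₗ[R] M''}
    (hfg : Function.Exact f g) (hg : Function.Surjective g) :
    Function.Exact (BimoduleTensor.map S C f) (BimoduleTensor.map S C g) := by
  intro x
  obtain ⟨x, rfl⟩ := (tensorEquiv S R C M').surjective x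
  rw [BimoduleTensor.map_tensorEquiv, EmbeddingLike.map_eq_zero_iff,
    Tensor.mapRight_exact C hfg hg x]
  constructor
  · rintro ⟨y, rfl⟩
    exact ⟨tensorEquiv S R C M y, rfl⟩
  · rintro ⟨y, hy⟩
    exact ⟨(tensorEquiv S R C M).symm y, (tensorEquiv S R C M').injective hy⟩

theorem BimoduleTensor.map_surjective {g : M →ₗ[R] M'} (hg : Function.Surjective g) :
    Function.Surjective (BimoduleTensor.map S C g) :=
  (tensorEquiv S R C M').surjective.comp
    ((Tensor.mapRight_surjective hg).comp (tensorEquiv S R C M).symm.surjective)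

/-! ### The left `R`-module `Hom_S(C, I)` -/

/-- The `S`-linear map underlying an element of `BimoduleHom S R C I`. -/
def BimoduleHom.toLin : BimoduleHom S R C I ≃+ (C →ₗ[S] I) := AddEquiv.refl _

theorem BimoduleHom.toLin_smul (r : R) (φ : BimoduleHom S R C I) (c : C) :
    toLin (r • φ) c = toLin φ (op r • c) := rfl

theorem BimoduleHom.toLin_zero (c : C) : toLin (0 : BimoduleHom S R C I) c = 0 := rfl

theorem BimoduleHom.toLin_sum {ι : Type*} (s : Finset ι) (φ : ι → BimoduleHom S R C I) (c : C) :
    toLin (∑ i ∈ s, φ i) c = ∑ i ∈ s, toLin (φ i) c := by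
  rw [map_sum, LinearMap.sum_apply]

theorem BimoduleHom.ext {φ ψ : BimoduleHom S R C I} (h : ∀ c, toLin φ c = toLin ψ c) : φ = ψ :=
  toLin.injective (LinearMap.ext h)

/-- The `R`-linear map `Hom_S(C, g)`. -/
def BimoduleHom.map (R : Type u) [Ring R] (C : Type u) [AddCommGroup C] [Module S C]
    [Module Rᵐᵒᵖ C] [SMulCommClass S Rᵐᵒᵖ C] (g : I →ₗ[S] I') :
    BimoduleHom S R C I →ₗ[R] BimoduleHom S R C I' where
  toFun φ := toLin.symm (g ∘ₗ toLin φ)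
  map_add' φ ψ := BimoduleHom.ext fun c => map_add g (toLin φ c) (toLin ψ c)
  map_smul' _ _ := rfl

/-! ### Unit and counit -/

/-- The natural map `M → Hom_S(C, C ⊗_R M)`. -/
def unitMap (S : Type u) [Ring S] (C : Type u) [AddCommGroup C] [Module S C]
    [Module Rᵐᵒᵖ C] [SMulCommClass S Rᵐᵒᵖ C] (M : Type u) [AddCommGroup M] [Module R M] :
    M →ₗ[R] BimoduleHom S R C (BimoduleTensor S R C M) where
  toFun m := BimoduleHom.toLin.symm
    { toFun := fun c => tensorEquiv S R C M (Tensor.tmul R c m)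
      map_add' := fun c c' => by rw [Tensor.add_tmul, map_add]
      map_smul' := fun s c => rfl }
  map_add' m m' := BimoduleHom.ext fun c =>
    (congrArg (tensorEquiv S R C M) (Tensor.tmul_add c m m')).trans (map_add _ _ _)
  map_smul' r m := BimoduleHom.ext fun c =>
    congrArg (tensorEquiv S R C M) (Tensor.smul_tmul r c m).symm

theorem toLin_unitMap (m : M) (c : C) : BimoduleHom.toLin (unitMap S C M m) c =
    tensorEquiv S R C M (Tensor.tmul R c m) := rfl

/-- The evaluation `C ⊗_R Hom_S(C, I) → I` on the underlying additive group. -/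
def evalHom (S R : Type u) [Ring S] [Ring R] (C : Type u) [AddCommGroup C] [Module S C]
    [Module Rᵐᵒᵖ C] [SMulCommClass S Rᵐᵒᵖ C] (I : Type u) [AddCommGroup I] [Module S I] :
    Tensor R C (BimoduleHom S R C I) →+ I :=
  Tensor.lift (AddMonoidHom.mk' (fun c => AddMonoidHom.mk' (fun φ => BimoduleHom.toLin φ c)
      (fun _ _ => rfl)) (fun c c' => AddMonoidHom.ext fun φ => map_add (BimoduleHom.toLin φ) c c'))
    (fun _ _ _ => rfl)

theorem evalHom_tmul (c : C) (φ : BimoduleHom S R C I) :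
    evalHom S R C I (Tensor.tmul R c φ) = BimoduleHom.toLin φ c := rfl

/-- The natural map `C ⊗_R Hom_S(C, I) → I`. -/
def counitMap (R : Type u) [Ring R] (C : Type u) [AddCommGroup C] [Module S C]
    [Module Rᵐᵒᵖ C] [SMulCommClass S Rᵐᵒᵖ C] (I : Type u) [AddCommGroup I] [Module S I] :
    BimoduleTensor S R C (BimoduleHom S R C I) →ₗ[S] I where
  toFun x := evalHom S R C I ((tensorEquiv S R C _).symm x)
  map_add' x y := by simp only [map_add]
  map_smul' s x := by
    obtain ⟨x, rfl⟩ := (tensorEquiv S R C _).surjective x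
    rw [smul_tensorEquiv, AddEquiv.symm_apply_apply, AddEquiv.symm_apply_apply, RingHom.id_apply]
    induction x using Tensor.induction_on with
    | tmul c φ => exact map_smul (BimoduleHom.toLin φ) s c
    | add x y hx hy => simp only [map_add, smul_add, hx, hy]

theorem counitMap_tensorEquiv (x : Tensor R C (BimoduleHom S R C I)) :
    counitMap R C I (tensorEquiv S R C _ x) = evalHom S R C I x := rfl

/-- One of the two triangle identities of the adjunction; `map_counitMap_unitMap` is the other. -/
theorem counitMap_map_unitMap (x : BimoduleTensor S R C M) :
    counitMap R C _ (BimoduleTensor.map S C (unitMap S C M) x) = x := by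
  obtain ⟨x, rfl⟩ := (tensorEquiv S R C M).surjective x
  rw [BimoduleTensor.map_tensorEquiv, counitMap_tensorEquiv]
  induction x using Tensor.induction_on with
  | tmul c m => rfl
  | add x y hx hy => simp only [map_add, hx, hy]

theorem map_counitMap_unitMap (φ : BimoduleHom S R C I) :
    BimoduleHom.map R C (counitMap R C I) (unitMap S C _ φ) = φ := rfl

theorem counitMap_naturality (g : I →ₗ[S] I') (x : BimoduleTensor S R C (BimoduleHom S R C I)) :
    counitMap R C I' (BimoduleTensor.map S C (BimoduleHom.map R C g) x) =
      g (counitMap R C I x) := by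
  obtain ⟨x, rfl⟩ := (tensorEquiv S R C _).surjective x
  rw [BimoduleTensor.map_tensorEquiv, counitMap_tensorEquiv, counitMap_tensorEquiv]
  induction x using Tensor.induction_on with
  | tmul c m => rfl
  | add x y hx hy => simp only [map_add, hx, hy]

theorem unitMap_naturality (g : M →ₗ[R] M') (m : M) :
    BimoduleHom.map R C (BimoduleTensor.map S C g) (unitMap S C M m) =
      unitMap S C M' (g m) := rfl

/-! ### Purity -/

/-- Solutions of a finite system in Hom_S(C, -) are homomorphisms out of the cokernel of a matrix
map C^l → C^k. That cokernel is finitely presented over S, so solutions lift. -/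
theorem SystemPure.bimoduleHom {f : I →ₗ[S] I'} {g : I' →ₗ[S] I''} (h : SystemPure f g)
    [Module.FinitePresentation S C] :
    SystemPure (BimoduleHom.map R C f) (BimoduleHom.map R C g) where
  injective φ ψ hφψ := BimoduleHom.ext fun c => h.injective
    (congrArg (fun χ => BimoduleHom.toLin χ c) hφψ)
  exact φ := by
    constructor
    · intro hφ
      obtain ⟨ψ, hψ⟩ := exists_factor_of_injective h.injective (φ := BimoduleHom.toLin φ)
        (fun c => (h.exact _).1 (congrArg (fun χ => BimoduleHom.toLin χ c) hφ))
      exact ⟨BimoduleHom.toLin.symm ψ, BimoduleHom.ext hψ⟩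
    · rintro ⟨ψ, rfl⟩
      exact BimoduleHom.ext fun c => h.exact.apply_apply_eq_zero _
  surjective φ := by
    obtain ⟨ψ, hψ⟩ := h.exists_lift (BimoduleHom.toLin φ)
    exact ⟨BimoduleHom.toLin.symm ψ, BimoduleHom.ext hψ⟩
  lift k l r d hd := by
    -- The transpose of r, since R acts on homomorphisms through their argument.
    let τ := rightMatrix S C (fun j i => op (r i j))
    let δ : (Fin k → C) →ₗ[S] I'' := ∑ j, BimoduleHom.toLin (d j) ∘ₗ LinearMap.proj j
    have hδ : ∀ x, δ x = ∑ j, BimoduleHom.toLin (d j) (x j) := fun x => by simp [δ]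
    have hT : LinearMap.range τ ≤ LinearMap.ker δ := by
      rintro _ ⟨x, rfl⟩
      rw [LinearMap.mem_ker, hδ]
      simp only [τ, rightMatrix_apply, map_sum]
      rw [Finset.sum_comm]
      refine Finset.sum_eq_zero fun i _ => ?_
      have := congrArg (fun χ => BimoduleHom.toLin χ (x i)) (hd i)
      simpa only [BimoduleHom.toLin_sum, BimoduleHom.toLin_smul, BimoduleHom.toLin_zero] using this
    have hfp : Module.FinitePresentation S ((Fin k → C) ⧸ LinearMap.range τ) := by
      refine Module.finitePresentation_of_surjective _ (LinearMap.range τ).mkQ_surjective ?_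
      rw [Submodule.ker_mkQ]
      exact Module.Finite.iff_fg.1 inferInstance
    obtain ⟨χ, hχ⟩ := h.exists_lift ((LinearMap.range τ).liftQ δ hT)
    refine ⟨fun j => BimoduleHom.toLin.symm (χ ∘ₗ (LinearMap.range τ).mkQ ∘ₗ
      LinearMap.single S (fun _ => C) j), fun j => BimoduleHom.ext fun c => ?_,
      fun i => BimoduleHom.ext fun c => ?_⟩
    · refine (hχ _).trans ?_
      change δ (Pi.single j c) = _
      rw [hδ, Finset.sum_eq_single j]
      · rw [Pi.single_eq_same]
      · intro i _ hij
        rw [Pi.single_eq_of_ne hij, map_zero]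
      · simp
    · rw [BimoduleHom.toLin_sum, BimoduleHom.toLin_zero]
      change ∑ j, χ ((LinearMap.range τ).mkQ (Pi.single j (op (r i j) • c))) = 0
      rw [← map_sum, ← map_sum]
      have : ∑ j, (Pi.single j (op (r i j) • c) : Fin k → C) = τ (Pi.single i c) := by
        funext j
        simp [τ, rightMatrix_apply, Finset.sum_apply, Pi.single_apply]
      rw [this, Submodule.mkQ_apply,
        (Submodule.Quotient.mk_eq_zero _).2 (LinearMap.mem_range_self τ _),
        map_zero]

/-- Solutions of a system in C ⊗ - form the kernel of β ⊗ - on C^k ⊗ -. Lift a solution to y over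
M'. The defect of y comes from some z over M that dies in coker β ⊗ M, because coker β is finitely
presented and the sequence is pure; hence z = β w, and y is corrected by the image of w. -/
theorem SystemPure.bimoduleTensor {f : M →ₗ[R] M'} {g : M' →ₗ[R] M''} (h : SystemPure f g)
    [Module.FinitePresentation Rᵐᵒᵖ C] :
    SystemPure (BimoduleTensor.map S C f) (BimoduleTensor.map S C g) where
  injective := (tensorEquiv S R C M').injective.comp
    ((h.mapRight_injective C).comp (tensorEquiv S R C M).symm.injective)
  exact := BimoduleTensor.map_exact h.exact h.surjective
  surjective := BimoduleTensor.map_surjective h.surjective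
  lift k l s d hd := by
    let β := leftMatrix R C s
    obtain ⟨x, hx⟩ := Tensor.exists_pi (fun j => (tensorEquiv S R C M'').symm (d j))
    have hβx : Tensor.map R M'' β x = 0 := by
      refine Tensor.pi_ext fun i => (tensorEquiv S R C M'').injective ?_
      rw [tensorEquiv_proj_leftMatrix, map_zero, map_zero]
      simp only [hx, AddEquiv.apply_symm_apply]
      exact hd i
    obtain ⟨y, rfl⟩ := Tensor.mapRight_surjective h.surjective x
    rw [Tensor.map_mapRight] at hβx
    obtain ⟨z, hz⟩ := (Tensor.mapRight_exact _ h.exact h.surjective _).1 hβx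
    let q := (LinearMap.range β).mkQ
    have hq : Function.Surjective q := Submodule.mkQ_surjective _
    have hβq : Function.Exact β q := β.exact_map_mkQ_range
    have hfp : Module.FinitePresentation Rᵐᵒᵖ ((Fin l → C) ⧸ LinearMap.range β) := by
      refine Module.finitePresentation_of_surjective _ hq ?_
      rw [Submodule.ker_mkQ]
      exact Module.Finite.iff_fg.1 inferInstance
    have hqz : Tensor.map R M q z = 0 := by
      refine h.mapRight_injective _ ?_
      rw [← Tensor.map_mapRight, hz, map_zero]
      exact (Tensor.map_exact M' hβq hq).apply_apply_eq_zero y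
    obtain ⟨w, rfl⟩ := (Tensor.map_exact M hβq hq z).1 hqz
    let y' := y - Tensor.mapRight _ f w
    have hy' : Tensor.map R M' β y' = 0 := by
      rw [map_sub, Tensor.map_mapRight, hz, sub_self]
    have hgy' : Tensor.mapRight _ g y' = Tensor.mapRight _ g y := by
      rw [map_sub, (Tensor.mapRight_exact _ h.exact h.surjective).apply_apply_eq_zero, sub_zero]
    refine ⟨fun j => tensorEquiv S R C M' (Tensor.map R M' (LinearMap.proj j) y'), fun j => ?_,
      fun i => ?_⟩
    · rw [BimoduleTensor.map_tensorEquiv, ← Tensor.map_mapRight, hgy', hx,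
        AddEquiv.apply_symm_apply]
    · rw [← tensorEquiv_proj_leftMatrix, hy', map_zero, map_zero]

/-! ### Semidualizing bimodules -/

/-- Applying Hom_S(-, C) to S^l → S^k → C → 0 gives 0 → R → C^k → C^l by the homothety isomorphism.
After - ⊗ M it exhibits M as the kernel of (C ⊗ M)^k → (C ⊗ M)^l, which is Hom_S(C, C ⊗ M). -/
theorem IsSemidualizing.unitMap_bijective (hC : IsSemidualizing S R C) (hM : WeakFlat R M) :
    Function.Bijective (unitMap (R := R) S C M) := by
  have := hC.left_superFinitelyPresented.finitePresentation
  have hCr := hC.right_superFinitelyPresented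
  obtain ⟨k, l, c, s, hc, hsc, hdesc⟩ := exists_generators_relations S C
  let α : Rᵐᵒᵖ →ₗ[Rᵐᵒᵖ] (Fin k → C) := LinearMap.toSpanSingleton Rᵐᵒᵖ _ c
  have hα : Function.Injective α := by
    rw [injective_iff_map_eq_zero]
    intro r hr
    have : (unop r : R) = 0 := by
      refine hC.right_homothety.1 (LinearMap.ext fun x => ?_)
      obtain ⟨a, rfl⟩ := hc x
      change rightMul S C r _ = rightMul S C (op (0 : R)) _
      simp only [map_sum, map_smul]
      refine Finset.sum_congr rfl fun j _ => congrArg (a j • ·) ?_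
      exact (congrFun hr j).trans (zero_smul _ _).symm
    rw [← op_unop r, this, op_zero]
  have hαβ : Function.Exact α (leftMatrix R C s) := by
    intro x
    constructor
    · intro hx
      obtain ⟨φ, hφ⟩ := hdesc C x (fun i => by
        rw [← leftMatrix_apply (R := R), hx]
        rfl)
      obtain ⟨r, hr⟩ := hC.right_homothety.2 φ
      exact ⟨op r, funext fun j => (LinearMap.congr_fun hr (c j)).trans (hφ j)⟩
    · rintro ⟨r, rfl⟩
      funext i
      rw [leftMatrix_apply]
      change ∑ j, s i j • r • c j = 0
      simp only [smul_comm (s i _) r, ← Finset.smul_sum, hsc, smul_zero]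
  obtain ⟨hinj, hex⟩ := hM.map_injective_and_exact superFinitelyPresented_of_projective
    (hCr.pi k) (hCr.pi l) hα hαβ
  have hproj : ∀ (j : Fin k) (m : M), Tensor.map R M (LinearMap.proj j)
      (Tensor.map R M α (Tensor.tmul R 1 m)) = Tensor.tmul R (c j) m := by
    intro j m
    rw [Tensor.map_tmul, Tensor.map_tmul]
    exact congrArg (fun x => Tensor.tmul R x m) (one_smul Rᵐᵒᵖ (c j))
  constructor
  · rw [injective_iff_map_eq_zero]
    intro m hm
    have h₀ : Tensor.tmul R (1 : Rᵐᵒᵖ) m = 0 := by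
      refine hinj (Tensor.pi_ext fun j => (tensorEquiv S R C M).injective ?_)
      rw [hproj, map_zero, map_zero, map_zero]
      exact congrArg (fun χ => BimoduleHom.toLin χ (c j)) hm
    have h₁ := congrArg (Tensor.ringHom R M) h₀
    rwa [Tensor.ringHom_tmul, unop_one, one_smul, map_zero] at h₁
  · intro φ
    obtain ⟨x, hx⟩ := Tensor.exists_pi
      (fun j => (tensorEquiv S R C M).symm (BimoduleHom.toLin φ (c j)))
    have hβx : Tensor.map R M (leftMatrix R C s) x = 0 := by
      refine Tensor.pi_ext fun i => (tensorEquiv S R C M).injective ?_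
      rw [tensorEquiv_proj_leftMatrix, map_zero, map_zero]
      simp only [hx, AddEquiv.apply_symm_apply]
      simp only [← map_smul, ← map_sum]
      rw [hsc, map_zero]
    obtain ⟨t, rfl⟩ := (hex x).1 hβx
    refine ⟨Tensor.ringHom R M t, BimoduleHom.ext fun y => ?_⟩
    obtain ⟨a, rfl⟩ := hc y
    simp only [map_sum, map_smul]
    refine Finset.sum_congr rfl fun j _ => congrArg (a j • ·) ?_
    rw [toLin_unitMap, ← hproj, ← Tensor.eq_one_tmul_ringHom, hx, AddEquiv.apply_symm_apply]

/-- Dually, a presentation of C over Rᵐᵒᵖ gives 0 → S → C^k → C^l. Hom_S(-, I) keeps it exact and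
exhibits I as the cokernel of Hom_S(C, I)^l → Hom_S(C, I)^k, which is C ⊗ Hom_S(C, I). -/
theorem IsSemidualizing.counitMap_bijective (hC : IsSemidualizing S R C)
    (hI : WeakInjective S I) : Function.Bijective (counitMap (S := S) R C I) := by
  have := hC.right_superFinitelyPresented.finitePresentation
  have hCl := hC.left_superFinitelyPresented
  obtain ⟨k, l, c, r, hc, hrc, hdesc⟩ := exists_generators_relations Rᵐᵒᵖ C
  let α : S →ₗ[S] (Fin k → C) := LinearMap.toSpanSingleton S _ c
  have hα : Function.Injective α := by
    rw [injective_iff_map_eq_zero]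
    intro s hs
    refine hC.left_homothety.1 (LinearMap.ext fun x => ?_)
    obtain ⟨a, rfl⟩ := hc x
    change leftMul R C s _ = leftMul R C (0 : S) _
    simp only [map_sum, map_smul]
    refine Finset.sum_congr rfl fun j _ => congrArg (a j • ·) ?_
    exact (congrFun hs j).trans (zero_smul _ _).symm
  have hαβ : Function.Exact α (rightMatrix S C r) := by
    intro x
    constructor
    · intro hx
      obtain ⟨φ, hφ⟩ := hdesc C x (fun i => by
        rw [← rightMatrix_apply (S := S), hx]
        rfl)
      obtain ⟨s, hs⟩ := hC.left_homothety.2 φ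
      exact ⟨s, funext fun j => (LinearMap.congr_fun hs (c j)).trans (hφ j)⟩
    · rintro ⟨s, rfl⟩
      funext i
      rw [rightMatrix_apply]
      change ∑ j, r i j • s • c j = 0
      simp only [← smul_comm s (r i _), ← Finset.smul_sum, hrc, smul_zero]
  obtain ⟨hext, hex⟩ := hI.exists_extension_and_exact superFinitelyPresented_of_projective
    (hCl.pi k) (hCl.pi l) hα hαβ
  have heval : ∀ m : Fin k → BimoduleHom S R C I,
      evalHom S R C I (∑ j, Tensor.tmul R (c j) (m j)) = ∑ j, BimoduleHom.toLin (m j) (c j) :=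
    fun m => by simp only [map_sum, evalHom_tmul]
  constructor
  · rw [injective_iff_map_eq_zero]
    intro x hx
    obtain ⟨x, rfl⟩ := (tensorEquiv S R C _).surjective x
    obtain ⟨m, rfl⟩ := Tensor.exists_eq_sum c (fun n => by
      obtain ⟨a, ha⟩ := hc n
      exact ⟨fun j => unop (a j), ha⟩) x
    rw [counitMap_tensorEquiv, heval] at hx
    let ψ : (Fin k → C) →ₗ[S] I := ∑ j, BimoduleHom.toLin (m j) ∘ₗ LinearMap.proj j
    have hψ : ∀ x, ψ x = ∑ j, BimoduleHom.toLin (m j) (x j) := fun x => by simp [ψ]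
    obtain ⟨χ, hχ⟩ := hex ψ (fun s => by
      rw [hψ]
      change ∑ j, BimoduleHom.toLin (m j) (s • c j) = 0
      simp only [map_smul, ← Finset.smul_sum, hx, smul_zero])
    -- Rewriting m_j through the relations turns ∑ c_j ⊗ m_j into a sum of terms (∑ c_j r_ij) ⊗ χ_i,
    -- each zero.
    have hm : ∀ j, m j = ∑ i, unop (r i j) •
        (BimoduleHom.toLin.symm (χ ∘ₗ LinearMap.single S (fun _ => C) i) :
          BimoduleHom S R C I) := by
      intro j
      refine BimoduleHom.ext fun y => ?_
      have h₁ : ψ (Pi.single j y) = BimoduleHom.toLin (m j) y := by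
        rw [hψ, Finset.sum_eq_single j]
        · rw [Pi.single_eq_same]
        · intro i _ hij
          rw [Pi.single_eq_of_ne hij, map_zero]
        · simp
      have h₂ : rightMatrix S C r (Pi.single j y) = ∑ i, Pi.single i (r i j • y) := by
        funext i
        simp [rightMatrix_apply, Finset.sum_apply, Pi.single_apply]
      rw [← h₁, ← hχ, h₂, map_sum, BimoduleHom.toLin_sum]
      rfl
    rw [EmbeddingLike.map_eq_zero_iff]
    simp only [hm, Tensor.tmul_sum, ← Tensor.smul_tmul, op_unop]
    rw [Finset.sum_comm]
    refine Finset.sum_eq_zero fun i _ => ?_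
    rw [← Tensor.sum_tmul, hrc, Tensor.zero_tmul]
  · intro x
    obtain ⟨ψ, hψ⟩ := hext (LinearMap.toSpanSingleton S I x)
    refine ⟨tensorEquiv S R C _ (∑ j, Tensor.tmul R (c j)
      (BimoduleHom.toLin.symm (ψ ∘ₗ LinearMap.single S (fun _ => C) j))), ?_⟩
    rw [counitMap_tensorEquiv, heval]
    change ∑ j, ψ (Pi.single j (c j)) = x
    rw [← map_sum, Finset.univ_sum_single]
    have := hψ 1
    rwa [LinearMap.toSpanSingleton_apply, LinearMap.toSpanSingleton_apply, one_smul,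
      one_smul] at this

/-- Let M⁺ be the character module Hom(M, ℚ/ℤ), with right action (χ r)(m) = χ(r m). A right linear
map C → M⁺ is a character of C ⊗ M, hence zero. Faithfulness on the right gives M⁺ = 0, and
characters separate points of M. -/
theorem IsFaithfullySemidualizing.subsingleton_of_tensor (hC : IsFaithfullySemidualizing S R C)
    (h : Subsingleton (Tensor R C M)) : Subsingleton M := by
  let _ : Module Rᵐᵒᵖ (M →+ AddCircle (1 : ℚ)) :=
    { smul := fun r χ => χ.comp (DistribSMul.toAddMonoidHom M (unop r))
      one_smul := fun χ => AddMonoidHom.ext fun m => congrArg χ (one_smul R m)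
      mul_smul := fun r r' χ => AddMonoidHom.ext fun m =>
        congrArg χ (mul_smul (unop r') (unop r) m)
      smul_zero := fun _ => rfl
      smul_add := fun _ _ _ => rfl
      add_smul := fun r r' χ => AddMonoidHom.ext fun m =>
        (congrArg χ (add_smul (unop r) (unop r') m)).trans (map_add χ _ _)
      zero_smul := fun χ => AddMonoidHom.ext fun m =>
        (congrArg χ (zero_smul R m)).trans (map_zero χ) }
  have hsub : Subsingleton (C →ₗ[Rᵐᵒᵖ] (M →+ AddCircle (1 : ℚ))) := by
    refine subsingleton_of_forall_eq 0 fun φ => LinearMap.ext fun c => AddMonoidHom.ext fun m => ?_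
    have hφ : ∀ (n : C) (r : R) (m : M), φ.toAddMonoidHom (op r • n) m =
        φ.toAddMonoidHom n (r • m) := fun n r m =>
      DFunLike.congr_fun (map_smul φ (op r) n) m
    have := congrArg (Tensor.lift φ.toAddMonoidHom hφ)
      (Subsingleton.elim (Tensor.tmul R c m) (Tensor.tmul R c 0))
    exact this.trans (map_zero (φ c))
  have := hC.right_faithful _ hsub
  refine subsingleton_of_forall_eq 0 fun m => CharacterModule.eq_zero_of_character_apply fun χ => ?_
  exact DFunLike.congr_fun (Subsingleton.elim (α := M →+ AddCircle (1 : ℚ)) χ 0) m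

end Bimodule

/-! ### Pure closure of the two classes. -/

section Main

variable {S R : Type u} [Ring S] [Ring R]
variable {C : Type u} [AddCommGroup C] [Module S C] [Module Rᵐᵒᵖ C] [SMulCommClass S Rᵐᵒᵖ C]

theorem SystemPure.congr_middle {A B B' D : Type u} [AddCommGroup A] [Module R A] [AddCommGroup B]
    [Module R B] [AddCommGroup B'] [Module R B'] [AddCommGroup D] [Module R D] {f : A →ₗ[R] B}
    {g : B →ₗ[R] D} (h : SystemPure f g) (e : B ≃ₗ[R] B') :
    SystemPure (e.toLinearMap ∘ₗ f) (g ∘ₗ e.symm.toLinearMap) where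
  injective := e.injective.comp h.injective
  exact b := (h.exact (e.symm b)).trans
    (exists_congr fun a => e.eq_symm_apply)
  surjective := h.surjective.comp e.symm.surjective
  lift k l r d hd := by
    obtain ⟨b, hb, hrb⟩ := h.lift k l r d hd
    refine ⟨fun j => e (b j), fun j => ?_, fun i => ?_⟩
    · rw [← hb, LinearMap.comp_apply, LinearEquiv.coe_coe, e.symm_apply_apply]
    · simp only [← map_smul, ← map_sum]
      rw [hrb, map_zero]

theorem WeakFlat.of_equiv {M M' : Type u} [AddCommGroup M] [Module R M] [AddCommGroup M']
    [Module R M'] (hM : WeakFlat R M) (e : M ≃ₗ[R] M') : WeakFlat R M' :=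
  (SystemPure.of_equiv e.symm).weakFlat_left hM

theorem WeakInjective.of_equiv {M M' : Type u} [AddCommGroup M] [Module R M] [AddCommGroup M']
    [Module R M'] (hM : WeakInjective R M) (e : M ≃ₗ[R] M') : WeakInjective R M' :=
  (SystemPure.of_equiv e.symm).weakInjective_left hM

/-- The canonical candidate for F is Hom_S(C, V); this leaves its weak flatness and the bijectivity
of the counit to check. -/
theorem cWeakFlat_of_counitMap_bijective {V : Type u} [AddCommGroup V] [Module S V]
    (h : WeakFlat R (BimoduleHom S R C V)) (hV : Function.Bijective (counitMap (S := S) R C V)) :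
    CWeakFlat S R C V :=
  ⟨BimoduleHom S R C V, inferInstance, inferInstance, h, ⟨(LinearEquiv.ofBijective _ hV).symm⟩⟩

theorem cWeakInjective_of_unitMap_bijective {U : Type u} [AddCommGroup U] [Module R U]
    (h : WeakInjective S (BimoduleTensor S R C U))
    (hU : Function.Bijective (unitMap (R := R) S C U)) : CWeakInjective S R C U :=
  ⟨BimoduleTensor S R C U, inferInstance, inferInstance, h, ⟨LinearEquiv.ofBijective _ hU⟩⟩

theorem IsFaithfullySemidualizing.cWeakFlat_of_systemPure
    (hC : IsFaithfullySemidualizing S R C) {V W D : Type u} [AddCommGroup V] [Module S V]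
    [AddCommGroup W] [Module S W] [AddCommGroup D] [Module S D] (hV : CWeakFlat S R C V)
    {f : W →ₗ[S] V} {g : V →ₗ[S] D} (h : SystemPure f g) :
    CWeakFlat S R C W ∧ CWeakFlat S R C D := by
  have := hC.left_superFinitelyPresented.finitePresentation
  have := hC.right_superFinitelyPresented.finitePresentation
  obtain ⟨F, _, _, hF, ⟨e⟩⟩ := hV
  replace h := h.congr_middle e
  generalize e.toLinearMap ∘ₗ f = f at h
  generalize g ∘ₗ e.symm.toLinearMap = g at h
  have h' := h.bimoduleHom (R := R) (C := C)
  have hμ := hC.unitMap_bijective hF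
  have hFV := hF.of_equiv (LinearEquiv.ofBijective _ hμ)
  have hFW := h'.weakFlat_left hFV
  have hFD := h'.weakFlat_right hFV
  -- By a triangle identity the counit is inverse to C ⊗ η, and η is already bijective at F.
  have hV : Function.Bijective (counitMap (S := S) R C (BimoduleTensor S R C F)) := by
    constructor
    · rw [injective_iff_map_eq_zero]
      intro x hx
      obtain ⟨y, rfl⟩ := BimoduleTensor.map_surjective (S := S) (C := C) hμ.2 x
      rw [counitMap_map_unitMap] at hx
      rw [hx, map_zero]
    · exact fun x => ⟨_, counitMap_map_unitMap x⟩
  have hD : Function.Bijective (counitMap (S := S) R C D) := by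
    constructor
    · rw [← LinearMap.ker_eq_bot, ← Submodule.subsingleton_iff_eq_bot]
      -- A map C → ker ε is, inside C ⊗ Hom_S(C, D), of the form η(d), since Hom_S(C, D) is weak
      -- flat. Composing with ε recovers d, so d = 0 and the map vanishes.
      refine hC.left_faithful _ (subsingleton_of_forall_eq 0 fun φ => ?_)
      obtain ⟨d, hd⟩ := (hC.unitMap_bijective hFD).2
        (BimoduleHom.toLin.symm ((LinearMap.ker (counitMap (S := S) R C D)).subtype ∘ₗ φ))
      have hd₀ : d = 0 := by
        rw [← map_counitMap_unitMap d, hd]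
        exact BimoduleHom.ext fun c => (φ c).2
      rw [hd₀, map_zero] at hd
      exact LinearMap.ext fun c =>
        Subtype.ext (congrArg (fun χ => BimoduleHom.toLin χ c) hd).symm
    · intro d
      obtain ⟨v, rfl⟩ := h.surjective d
      obtain ⟨x, rfl⟩ := hV.2 v
      exact ⟨_, counitMap_naturality g x⟩
  have hW : Function.Bijective (counitMap (S := S) R C W) := by
    have hT := h'.bimoduleTensor (S := S) (C := C)
    constructor
    · refine Function.Injective.of_comp (f := f) ?_
      have : f ∘ counitMap (S := S) R C W = counitMap (S := S) R C _ ∘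
          BimoduleTensor.map S C (BimoduleHom.map R C f) :=
        funext fun x => (counitMap_naturality f x).symm
      rw [this]
      exact hV.1.comp hT.injective
    · intro w
      obtain ⟨x, hx⟩ := hV.2 (f w)
      -- Injectivity of the counit at D shows that the preimage x of f w comes from C ⊗ Hom_S(C, W).
      have hgx : BimoduleTensor.map S C (BimoduleHom.map R C g) x = 0 := by
        refine hD.1 ?_
        rw [counitMap_naturality, hx, h.exact.apply_apply_eq_zero, map_zero]
      obtain ⟨y, rfl⟩ := (hT.exact x).1 hgx
      exact ⟨y, h.injective ((counitMap_naturality f y).symm.trans hx)⟩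
  exact ⟨cWeakFlat_of_counitMap_bijective hFW hW, cWeakFlat_of_counitMap_bijective hFD hD⟩

theorem IsFaithfullySemidualizing.cWeakInjective_of_systemPure
    (hC : IsFaithfullySemidualizing S R C) {U W D : Type u} [AddCommGroup U] [Module R U]
    [AddCommGroup W] [Module R W] [AddCommGroup D] [Module R D] (hU : CWeakInjective S R C U)
    {f : W →ₗ[R] U} {g : U →ₗ[R] D} (h : SystemPure f g) :
    CWeakInjective S R C W ∧ CWeakInjective S R C D := by
  have := hC.left_superFinitelyPresented.finitePresentation
  have := hC.right_superFinitelyPresented.finitePresentation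
  obtain ⟨I, _, _, hI, ⟨e⟩⟩ := hU
  replace h := h.congr_middle e
  generalize e.toLinearMap ∘ₗ f = f at h
  generalize g ∘ₗ e.symm.toLinearMap = g at h
  have h' := h.bimoduleTensor (S := S) (C := C)
  have hν := hC.counitMap_bijective hI
  have hIU := hI.of_equiv (LinearEquiv.ofBijective _ hν).symm
  have hIW := h'.weakInjective_left hIU
  have hID := h'.weakInjective_right hIU
  have hH := h'.bimoduleHom (R := R) (C := C)
  have hU : Function.Bijective (unitMap (R := R) S C (BimoduleHom S R C I)) := by
    refine ⟨Function.LeftInverse.injective map_counitMap_unitMap, fun x =>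
      ⟨BimoduleHom.map R C (counitMap R C I) x, BimoduleHom.ext fun c => hν.1 ?_⟩⟩
    exact congrArg (fun χ => BimoduleHom.toLin χ c)
      (map_counitMap_unitMap (BimoduleHom.map R C (counitMap R C I) x))
  have hW : Function.Bijective (unitMap (R := R) S C W) := by
    constructor
    · refine Function.Injective.of_comp
        (f := BimoduleHom.map R C (BimoduleTensor.map S C f)) ?_
      exact hU.1.comp h.injective
    · let q := (LinearMap.range (unitMap (R := R) S C W)).mkQ
      have hq : Function.Surjective q := Submodule.mkQ_surjective _
      have hex := BimoduleTensor.map_exact (S := S) (C := C)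
        (unitMap (R := R) S C W).exact_map_mkQ_range hq
      -- C ⊗ W is weak injective, so its counit is bijective; C ⊗ η is a one-sided inverse of it,
      -- hence surjective. Therefore C ⊗ coker η = 0, and coker η = 0 by faithfulness.
      have hsurj : Function.Surjective (BimoduleTensor.map S C (unitMap (R := R) S C W)) :=
        fun y => ⟨counitMap R C _ y,
          (hC.counitMap_bijective hIW).1 (counitMap_map_unitMap _)⟩
      have hsub : Subsingleton
          (Tensor R C (_ ⧸ LinearMap.range (unitMap (R := R) S C W))) := by
        refine subsingleton_of_forall_eq 0 fun x => (tensorEquiv S R C _).injective ?_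
        obtain ⟨y, hy⟩ := BimoduleTensor.map_surjective (S := S) (C := C) hq (tensorEquiv S R C _ x)
        rw [← hy, map_zero]
        exact (hex y).2 (hsurj y)
      have := hC.subsingleton_of_tensor hsub
      exact LinearMap.range_eq_top.1 (Submodule.Quotient.subsingleton_iff.1 this)
  have hD : Function.Bijective (unitMap (R := R) S C D) := by
    constructor
    · rw [injective_iff_map_eq_zero]
      intro d hd
      obtain ⟨u, rfl⟩ := h.surjective d
      obtain ⟨x, hx⟩ := (hH.exact (unitMap S C _ u)).1 hd
      obtain ⟨w, rfl⟩ := hW.2 x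
      rw [unitMap_naturality] at hx
      rw [← hU.1 hx, h.exact.apply_apply_eq_zero]
    · intro x
      obtain ⟨y, rfl⟩ := hH.surjective x
      obtain ⟨u, rfl⟩ := hU.2 y
      exact ⟨g u, rfl⟩
  exact ⟨cWeakInjective_of_unitMap_bijective hIW hW, cWeakInjective_of_unitMap_bijective hID hD⟩

end Main

end SemidualizingBimodule

theorem proposition2p11 (S R : Type u) [Ring S] [Ring R]
    (C : Type u) [AddCommGroup C] [Module S C] [Module Rᵐᵒᵖ C] [SMulCommClass S Rᵐᵒᵖ C]
    (hC : SemidualizingBimodule.IsFaithfullySemidualizing S R C) :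
    (∀ (V W : Type u) [AddCommGroup V] [Module S V] [AddCommGroup W] [Module S W],
        SemidualizingBimodule.CWeakFlat S R C V →
        (SemidualizingBimodule.IsPureSubmoduleOf S W V →
          SemidualizingBimodule.CWeakFlat S R C W) ∧
        (SemidualizingBimodule.IsPureQuotientOf S W V →
          SemidualizingBimodule.CWeakFlat S R C W)) ∧
    (∀ (U W : Type u) [AddCommGroup U] [Module R U] [AddCommGroup W] [Module R W],
        SemidualizingBimodule.CWeakInjective S R C U →
        (SemidualizingBimodule.IsPureSubmoduleOf R W U →
          SemidualizingBimodule.CWeakInjective S R C W) ∧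
        (SemidualizingBimodule.IsPureQuotientOf R W U →
          SemidualizingBimodule.CWeakInjective S R C W)) := by
  refine ⟨fun V W _ _ _ _ hV => ⟨?_, ?_⟩, fun U W _ _ _ _ hU => ⟨?_, ?_⟩⟩
  · rintro ⟨D, _, _, f, g, h⟩
    exact (hC.cWeakFlat_of_systemPure hV h.systemPure).1
  · rintro ⟨A, _, _, f, g, h⟩
    exact (hC.cWeakFlat_of_systemPure hV h.systemPure).2
  · rintro ⟨D, _, _, f, g, h⟩
    exact (hC.cWeakInjective_of_systemPure hU h.systemPure).1
  · rintro ⟨A, _, _, f, g, h⟩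
    exact (hC.cWeakInjective_of_systemPure hU h.systemPure).2
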